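/- Let $n$ be a natural number, let $Q=[-1/2,1/2]^n$, and let $C_0^\infty$ denote the complex-valued smooth functions with compact support. For a bounded function $\sigma$ on $\mathbb{R}^n\times\mathbb{R}^n$ (measurable) and Schwartz functions $f,g$ on $\mathbb{R}^n$ put $$T_\sigma(f,g)(x)=\iint_{\mathbb{R}^n\times\mathbb{R}^n}e^{2\pi i x\cdot(\xi+\eta)}\sigma(\xi,\eta)\widehat f(\xi)\widehat g(\eta)\,d\xi\,d\eta,\qquad \widehat f(\xi)=\int_{\mathbb{R}^n} e^{-2\pi i x\cdot\xi}f(x)\,dx.$$ For $1\le q\le\infty$ let $\|h\|_{(L^2,\ell^q)}$ be the $\ell^q$ norm over $\nu\in\mathbb{Z}^n$ of the numbers $\big(\int_Q|h(x+\nu)|^2dx\big)^{1/2}$, and let $$\|\sigma\|_{\mathcal M(L^2\times L^2\to(L^2,\ell^q))}=\sup\{\|T_\sigma(f,g)\|_{(L^2,\ell^q)} : f,g\in\mathcal S(\mathbb{R}^n),\ \|f\|_{L^2}=\|g\|_{L^2}=1\}\in[0,\infty].$$ An $L^\infty$ matrix is a family $A=(a_{\mu,\nu})_{\mu,\nu\in\mathbb{Z}^n}$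 of complex numbers with $\sup_{\mu,\nu}|a_{\mu,\nu}|<\infty$. For such $A$ let $$\|A\|_{\mathcal B}=\sup\Big|\sum_{\mu,\nu\in\mathbb{Z}^n}a_{\mu,\nu}F(\mu)G(\nu)H(\mu+\nu)\Big|\in[0,\infty],$$ the supremum being over all finitely supported $F,G,H:\mathbb{Z}^n\to\mathbb{C}$ with $\|F\|_{\ell^2}=\|G\|_{\ell^2}=\|H\|_{\ell^2}=1$, and, for $\Phi\in C_0^\infty(\mathbb{R}^n\times\mathbb{R}^n)$, let $\sigma_{A,\Phi}(\xi,\eta)=\sum_{\mu,\nu\in\mathbb{Z}^n}a_{\mu,\nu}\Phi(\xi-\mu,\eta-\nu)$. (1) For every $\Phi\in C_0^\infty(\mathbb{R}^n\times\mathbb{R}^n)$ there is a constant $c\in(0,\infty)$, depending only on $n$ and $\Phi$, such that $$\|\sigma_{A,\Phi}\|_{\mathcal M(L^2\times L^2\to(L^2,\ell^1))}\le c\,\|A\|_{\mathcal B}$$ for all $L^\infty$ matrices $A$. (2) Suppose that $\Phi\in C_0^\infty(\mathbb{R}^n\times\mathbb{R}^n)$ satisfies condition (A): there is a function $\Theta\in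 C_0^\infty(\mathbb{R}^n\times\mathbb{R}^n)$ such that, for $\alpha,\beta\in\mathbb{Z}^n$, the integral $\iint\Theta(\xi,\eta)\Phi(\xi-\alpha,\eta-\beta)\,d\xi\,d\eta$ equals $1$ if $(\alpha,\beta)=(0,0)$ and $0$ otherwise. Then there is a constant $c\in(0,\infty)$, depending only on $n$ and $\Phi$, such that $$\|\sigma_{A,\Phi}\|_{\mathcal M(L^2\times L^2\to(L^2,\ell^\infty))}\ge c^{-1}\|A\|_{\mathcal B}$$ for all $L^\infty$ matrices $A$. -/

import Mathlib

open MeasureTheory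
open scoped ENNReal NNReal SchwartzMap FourierTransform ContDiff

noncomputable section

namespace BilinearMultiplier

/-- The Euclidean space `ℝⁿ`. -/
abbrev Rn (n : ℕ) : Type := EuclideanSpace ℝ (Fin n)

/-- The integer lattice `ℤⁿ`. -/
abbrev Zn (n : ℕ) : Type := Fin n → ℤ

/-- The inclusion of `ℤⁿ` in `ℝⁿ`. -/
def toRn {n : ℕ} (μ : Zn n) : Rn n := WithLp.toLp 2 fun i => (μ i : ℝ)

/-- The class `C₀^∞(V)`: complex-valued smooth functions with compact support. -/
def IsTestFunction {V : Type*} [NormedAddCommGroup V] [NormedSpace ℝ V] (Φ : V → ℂ) : Prop :=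
  ContDiff ℝ ∞ Φ ∧ HasCompactSupport Φ

/-- A matrix on `ℤⁿ × ℤⁿ` is an `L^∞` matrix if its entries are uniformly bounded. -/
def IsBoundedMatrix {n : ℕ} (a : Zn n → Zn n → ℂ) : Prop :=
  ∃ M : ℝ, ∀ μ ν, ‖a μ ν‖ ≤ M

/-- The multiplier `σ_{A,Φ}(ξ, η) = ∑_{μ,ν} a_{μ,ν} Φ(ξ - μ, η - ν)`. For compactly supported `Φ`
only finitely many terms are nonzero at each point. -/
def sigma {n : ℕ} (a : Zn n → Zn n → ℂ) (Φ : Rn n × Rn n → ℂ) : Rn n × Rn n → ℂ :=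
  fun p => ∑' m : Zn n × Zn n, a m.1 m.2 * Φ (p.1 - toRn m.1, p.2 - toRn m.2)

/-- The bilinear Fourier multiplier operator
`T_σ(f, g)(x) = ∬ e^{2πi x·(ξ+η)} σ(ξ, η) f̂(ξ) ĝ(η) dξ dη` on Schwartz functions, with
`f̂(ξ) = ∫ e^{-2πi x·ξ} f(x) dx`. -/
def bilinearOp {n : ℕ} (σ : Rn n × Rn n → ℂ) (f g : 𝓢(Rn n, ℂ)) : Rn n → ℂ :=
  fun x => ∫ p : Rn n × Rn n,
    Complex.exp (2 * Real.pi * Complex.I * (inner ℝ x (p.1 + p.2) : ℝ)) * σ p *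
      𝓕 (f : Rn n → ℂ) p.1 * 𝓕 (g : Rn n → ℂ) p.2

/-- The norm `‖σ‖_{M(X × Y → Z)}`, the supremum of `‖T_σ(f, g)‖_Z` over all Schwartz functions
`f, g` with `‖f‖_X = ‖g‖_Y = 1`; it may be infinite. -/
def multiplierNorm {n : ℕ} (X Y Z : (Rn n → ℂ) → ℝ≥0∞) (σ : Rn n × Rn n → ℂ) : ℝ≥0∞ :=
  ⨆ (f : 𝓢(Rn n, ℂ)) (g : 𝓢(Rn n, ℂ)) (_ : X f = 1) (_ : Y g = 1), Z (bilinearOp σ f g)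

/-- The `L²` norm on `ℝⁿ`. -/
def L2norm {n : ℕ} (f : Rn n → ℂ) : ℝ≥0∞ := eLpNorm f 2 volume

/-- The cube `Q = [-1/2, 1/2]ⁿ`. -/
def cube (n : ℕ) : Set (Rn n) := {x | ∀ i, x i ∈ Set.Icc (-1 / 2 : ℝ) (1 / 2)}

/-- The norm of the amalgam space `(L^p, ℓ^q)`: the `ℓ^q` norm over `ν ∈ ℤⁿ` (the `L^q` norm for
the counting measure) of the `L^p(Q)` norm of `x ↦ f(x + ν)`. -/
def amalgamNorm {n : ℕ} (p q : ℝ≥0∞) (f : Rn n → ℂ) : ℝ≥0∞ :=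
  eLpNorm (fun ν : Zn n => eLpNorm (fun x => f (x + toRn ν)) p (volume.restrict (cube n)))
    q Measure.count

/-- The `ℓ²` norm of a finitely supported function on `ℤⁿ`. -/
def l2norm {n : ℕ} (F : Zn n →₀ ℂ) : ℝ := Real.sqrt (∑ μ ∈ F.support, ‖F μ‖ ^ 2)

/-- The trilinear form `∑_{μ,ν} a_{μ,ν} F(μ) G(ν) H(μ+ν)` on finitely supported functions. -/
def trilinearForm {n : ℕ} (a : Zn n → Zn n → ℂ) (F G H : Zn n →₀ ℂ) : ℂ :=
  ∑ μ ∈ F.support, ∑ ν ∈ G.support, a μ ν * F μ * G ν * H (μ + ν)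

/-- The norm `‖A‖_B`, the supremum of the absolute value of the trilinear form over all finitely
supported `F, G, H` of `ℓ²` norm one; it may be infinite. -/
def Bnorm {n : ℕ} (a : Zn n → Zn n → ℂ) : ℝ≥0∞ :=
  ⨆ (F : Zn n →₀ ℂ) (G : Zn n →₀ ℂ) (H : Zn n →₀ ℂ)
    (_ : l2norm F = 1) (_ : l2norm G = 1) (_ : l2norm H = 1), ‖trilinearForm a F G H‖ₑ

/-- Condition (A) for a function on `ℝⁿ × ℝⁿ`. -/
def ConditionA {n : ℕ} (Φ : Rn n × Rn n → ℂ) : Prop :=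
  ∃ Θ : Rn n × Rn n → ℂ, IsTestFunction Θ ∧
    ∀ α β : Zn n, ∫ p : Rn n × Rn n, Θ p * Φ (p.1 - toRn α, p.2 - toRn β) =
      if α = 0 ∧ β = 0 then 1 else 0

end BilinearMultiplier

end

/-!
Fourier inversion writes `e^{2πi y·(ξ+η)} Φ(ξ, η)`, for `y ∈ Q`, as an absolutely convergent
superposition of products of characters in `y`, `ξ` and `η`. On each lattice cube the operator with
multiplier `σ_{A,Φ}` is therefore a superposition of trigonometric polynomials
`∑ a_{μ,ν} F(μ) G(ν) e^{2πi y·(μ+ν)}`, where `F` and `G` are the packet coefficients of `f̂` and `ĝ`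
on that cube. By Plancherel on `Q` and duality, `‖A‖_B` is the best constant bounding the `L²(Q)`
norm of such a polynomial by `‖F‖_{ℓ²} ‖G‖_{ℓ²}`. For the upper bound, Cauchy–Schwarz over the cubes
and Bessel's inequality for the packets sum these estimates. For the lower bound, `Θ` recovers `A`
from `σ_{A,Φ}`, so that the same expansion, now of `e^{-2πi y·(ξ+η)} Θ(ξ, η)`, exhibits each
trigonometric polynomial as a superposition on `Q` of values `T_σ(f, g)`.
-/

noncomputable section

namespace BilinearMultiplier

open scoped InnerProductSpace

lemma fourierChar_eq_exp (t : ℝ) : (𝐞 t : ℂ) = Complex.exp (2 * Real.pi * Complex.I * t) := by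
  rw [Real.fourierChar_apply]
  push_cast
  ring_nf

@[simp] lemma norm_fourierChar (t : ℝ) : ‖(𝐞 t : ℂ)‖ = 1 := Circle.norm_coe _

@[simp] lemma enorm_fourierChar (t : ℝ) : ‖(𝐞 t : ℂ)‖ₑ = 1 := by
  rw [← ofReal_norm, norm_fourierChar, ENNReal.ofReal_one]

lemma fourierChar_add (s t : ℝ) : (𝐞 (s + t) : ℂ) = 𝐞 s * 𝐞 t := by
  rw [AddChar.map_add_eq_mul, Circle.coe_mul]

@[simp] lemma fourierChar_intCast (m : ℤ) : (𝐞 (m : ℝ) : ℂ) = 1 := by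
  rw [fourierChar_eq_exp, Complex.exp_eq_one_iff]
  exact ⟨m, by push_cast; ring⟩

lemma contDiff_fourierChar : ContDiff ℝ ∞ fun t : ℝ => (𝐞 t : ℂ) := by
  simp only [fourierChar_eq_exp]
  exact Complex.contDiff_exp.comp (contDiff_const.mul Complex.ofRealCLM.contDiff)

section ComplexENorm

lemma enorm_sq_eq_ofReal (z : ℂ) : ‖z‖ₑ ^ 2 = ENNReal.ofReal (‖z‖ ^ 2) := by
  rw [← ofReal_norm, ENNReal.ofReal_pow (norm_nonneg _)]

lemma enorm_ofReal_of_nonneg {x : ℝ} (hx : 0 ≤ x) : ‖(x : ℂ)‖ₑ = ENNReal.ofReal x := by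
  rw [← ofReal_norm, Complex.norm_of_nonneg hx]

variable {ι : Type*}

lemma enorm_sum_conj_mul_self (S : Finset ι) (c : ι → ℂ) :
    ‖∑ i ∈ S, (starRingEnd ℂ) (c i) * c i‖ₑ = ∑ i ∈ S, ‖c i‖ₑ ^ 2 := by
  simp_rw [Complex.conj_mul', enorm_sq_eq_ofReal]
  rw [← ENNReal.ofReal_sum_of_nonneg fun _ _ => by positivity,
    ← enorm_ofReal_of_nonneg (by positivity)]
  push_cast
  rfl

lemma enorm_sum_sq_le_card (S : Finset ι) (f : ι → ℂ) :
    ‖∑ i ∈ S, f i‖ₑ ^ 2 ≤ S.card * ∑ i ∈ S, ‖f i‖ₑ ^ 2 := by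
  have h : ‖∑ i ∈ S, f i‖₊ ^ 2 ≤ S.card * ∑ i ∈ S, ‖f i‖₊ ^ 2 :=
    (pow_le_pow_left' (nnnorm_sum_le _ _) 2).trans sq_sum_le_card_mul_sum_sq
  simp only [enorm_eq_nnnorm]
  exact_mod_cast h

end ComplexENorm

section LTwo

lemma sq_rpow_half (x : ℝ≥0∞) : (x ^ 2) ^ (1 / 2 : ℝ) = x := by
  simpa using ENNReal.pow_rpow_inv_natCast two_ne_zero x

lemma rpow_half_sq (x : ℝ≥0∞) : (x ^ (1 / 2 : ℝ)) ^ 2 = x := by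
  simpa using ENNReal.rpow_inv_natCast_pow two_ne_zero x

lemma le_of_sq_le_mul {x k : ℝ≥0∞} (hx : x ≠ ⊤) (h : x ^ 2 ≤ k * x) : x ≤ k := by
  rcases eq_or_ne x 0 with rfl | h0
  · exact zero_le
  · rw [sq] at h
    exact (ENNReal.mul_le_mul_iff_left h0 hx).1 h

variable {α β ι E : Type*} [MeasurableSpace α] [MeasurableSpace β] [NormedAddCommGroup E]

lemma lintegral_mul_le_sqrt_mul_sqrt (μ : Measure α) {f g : α → ℝ≥0∞} (hf : AEMeasurable f μ)
    (hg : AEMeasurable g μ) :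
    ∫⁻ x, f x * g x ∂μ ≤ (∫⁻ x, f x ^ 2 ∂μ) ^ (1 / 2 : ℝ) * (∫⁻ x, g x ^ 2 ∂μ) ^ (1 / 2 : ℝ) := by
  simpa using ENNReal.lintegral_mul_le_Lp_mul_Lq μ Real.HolderConjugate.two_two hf hg

lemma tsum_mul_le_sqrt_mul_sqrt (f g : ι → ℝ≥0∞) :
    ∑' i, f i * g i ≤ (∑' i, f i ^ 2) ^ (1 / 2 : ℝ) * (∑' i, g i ^ 2) ^ (1 / 2 : ℝ) := by
  let _ : MeasurableSpace ι := ⊤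
  simpa only [lintegral_count] using lintegral_mul_le_sqrt_mul_sqrt (Measure.count : Measure ι)
    (f := f) (g := g) measurable_from_top.aemeasurable measurable_from_top.aemeasurable

lemma eLpNorm_two_eq (μ : Measure α) (f : α → E) :
    eLpNorm f 2 μ = (∫⁻ x, ‖f x‖ₑ ^ 2 ∂μ) ^ (1 / 2 : ℝ) := by
  simpa using eLpNorm_eq_lintegral_rpow_enorm_toReal (f := f) (μ := μ) two_ne_zero
    ENNReal.ofNat_ne_top

lemma eLpNorm_two_sq (μ : Measure α) (f : α → E) :
    eLpNorm f 2 μ ^ 2 = ∫⁻ x, ‖f x‖ₑ ^ 2 ∂μ := by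
  rw [eLpNorm_two_eq, rpow_half_sq]

lemma eLpNorm_two_le_of_sq_le {μ : Measure α} {f : α → E} {K : ℝ≥0∞}
    (h : ∫⁻ x, ‖f x‖ₑ ^ 2 ∂μ ≤ K ^ 2) : eLpNorm f 2 μ ≤ K := by
  rwa [← eLpNorm_two_sq, ENNReal.pow_le_pow_left_iff two_ne_zero] at h

variable (μ : Measure α) (ν : Measure β) [SFinite μ] [SFinite ν]

/-- **Minkowski's integral inequality** in `L²`, for nonnegative functions. -/
lemma lintegral_lintegral_sq_le {u : β → α → ℝ≥0∞} (hu : Measurable (Function.uncurry u)) :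
    ∫⁻ y, (∫⁻ w, u w y ∂ν) ^ 2 ∂μ ≤ (∫⁻ w, (∫⁻ y, u w y ^ 2 ∂μ) ^ (1 / 2 : ℝ) ∂ν) ^ 2 := by
  have hu_left : ∀ w, Measurable (u w) := fun w => hu.comp measurable_prodMk_left
  have hu_right : ∀ y, Measurable fun w => u w y := fun y => hu.comp measurable_prodMk_right
  have hN : Measurable fun w => (∫⁻ y, u w y ^ 2 ∂μ) ^ (1 / 2 : ℝ) :=
    (Measurable.lintegral_prod_right' (f := fun p : β × α => u p.1 p.2 ^ 2)
      (hu.pow_const 2)).pow_const _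
  calc ∫⁻ y, (∫⁻ w, u w y ∂ν) ^ 2 ∂μ
      = ∫⁻ y, ∫⁻ w, ∫⁻ w', u w y * u w' y ∂ν ∂ν ∂μ := by
        refine lintegral_congr fun y => ?_
        rw [lintegral_lintegral_mul (hu_right y).aemeasurable (hu_right y).aemeasurable, sq]
    _ = ∫⁻ w, ∫⁻ y, ∫⁻ w', u w y * u w' y ∂ν ∂μ ∂ν := by
        refine lintegral_lintegral_swap (Measurable.aemeasurable ?_)
        refine Measurable.lintegral_prod_right'
          (f := fun p : (α × β) × β => u p.1.2 p.1.1 * u p.2 p.1.1) ?_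
        exact (hu.comp (f := fun p : (α × β) × β => (p.1.2, p.1.1)) (by fun_prop)).mul
          (hu.comp (f := fun p : (α × β) × β => (p.2, p.1.1)) (by fun_prop))
    _ = ∫⁻ w, ∫⁻ w', ∫⁻ y, u w y * u w' y ∂μ ∂ν ∂ν := by
        refine lintegral_congr fun w => lintegral_lintegral_swap (Measurable.aemeasurable ?_)
        exact ((hu_left w).comp measurable_fst).mul
          (hu.comp (f := fun p : α × β => (p.2, p.1)) (by fun_prop))
    _ ≤ ∫⁻ w, ∫⁻ w', (∫⁻ y, u w y ^ 2 ∂μ) ^ (1 / 2 : ℝ) *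
          (∫⁻ y, u w' y ^ 2 ∂μ) ^ (1 / 2 : ℝ) ∂ν ∂ν :=
        lintegral_mono fun w => lintegral_mono fun w' =>
          lintegral_mul_le_sqrt_mul_sqrt μ (hu_left w).aemeasurable (hu_left w').aemeasurable
    _ = _ := by
        rw [lintegral_lintegral_mul hN.aemeasurable hN.aemeasurable, sq]

/-- **Minkowski's integral inequality** in `L²`. -/
lemma eLpNorm_two_integral_le [NormedSpace ℝ E] [MeasurableSpace E] [OpensMeasurableSpace E]
    {u : β → α → E} (hu : Measurable (Function.uncurry u)) :
    eLpNorm (fun y => ∫ w, u w y ∂ν) 2 μ ≤ ∫⁻ w, eLpNorm (u w) 2 μ ∂ν := by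
  refine eLpNorm_two_le_of_sq_le ?_
  simp_rw [eLpNorm_two_eq]
  refine le_trans ?_ (lintegral_lintegral_sq_le μ ν (u := fun w y => ‖u w y‖ₑ) hu.enorm)
  gcongr with y
  exact enorm_integral_le_lintegral_enorm _

end LTwo

variable {n : ℕ}

section Lattice

lemma toRn_add (μ ν : Zn n) : toRn (μ + ν) = toRn μ + toRn ν := by
  ext i; simp [toRn]

lemma toRn_sub (μ ν : Zn n) : toRn (μ - ν) = toRn μ - toRn ν := by
  ext i; simp [toRn]

@[simp] lemma toRn_zero : toRn (0 : Zn n) = 0 := by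
  ext i; simp [toRn]

lemma inner_toRn (x : Rn n) (μ : Zn n) : ⟪x, toRn μ⟫_ℝ = ∑ i, x i * μ i := by
  simp [PiLp.inner_apply, toRn, mul_comm]

lemma fourierChar_inner_toRn (μ ν : Zn n) : (𝐞 ⟪toRn μ, toRn ν⟫_ℝ : ℂ) = 1 := by
  have h : ⟪toRn μ, toRn ν⟫_ℝ = ((∑ i, μ i * ν i : ℤ) : ℝ) := by
    rw [inner_toRn]; simp [toRn]
  rw [h, fourierChar_intCast]

lemma fourierChar_inner_add_toRn (x : Rn n) (μ ν : Zn n) :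
    (𝐞 ⟪x + toRn μ, toRn ν⟫_ℝ : ℂ) = 𝐞 ⟪x, toRn ν⟫_ℝ := by
  rw [inner_add_left, fourierChar_add, fourierChar_inner_toRn, mul_one]

lemma exists_card_le_of_norm_sub_toRn_le (n : ℕ) (r : ℝ) :
    ∃ C : ℕ, ∀ (x : Rn n) (S : Finset (Zn n)), (∀ μ ∈ S, ‖x - toRn μ‖ ≤ r) → S.card ≤ C := by
  refine ⟨(⌈2 * r⌉₊ + 1) ^ n, fun x S hS => ?_⟩
  have hsub : S ⊆ Fintype.piFinset fun i => Finset.Icc ⌈x i - r⌉ (⌈x i - r⌉ + ⌈2 * r⌉₊) := by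
    intro μ hμ
    rw [Fintype.mem_piFinset]
    intro i
    obtain ⟨hl, hr⟩ : -r ≤ x i - μ i ∧ x i - μ i ≤ r := abs_le.1 <| by
      simpa [toRn] using (PiLp.norm_apply_le (x - toRn μ) i).trans (hS μ hμ)
    refine Finset.mem_Icc.2 ⟨Int.ceil_le.2 (by linarith), ?_⟩
    have h : (μ i : ℝ) ≤ ((⌈x i - r⌉ + ⌈2 * r⌉₊ : ℤ) : ℝ) := by
      push_cast
      linarith [Int.le_ceil (x i - r), Nat.le_ceil (2 * r)]
    exact_mod_cast h
  refine (Finset.card_le_card hsub).trans_eq ?_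
  have hcard : ∀ m : ℤ, (m + (⌈2 * r⌉₊ : ℤ) + 1 - m).toNat = ⌈2 * r⌉₊ + 1 := fun m => by omega
  simp [Fintype.card_piFinset, hcard]

lemma finite_lattice_near (x : Rn n) (r : ℝ) : {μ : Zn n | ‖x - toRn μ‖ ≤ r}.Finite := by
  obtain ⟨C, hC⟩ := exists_card_le_of_norm_sub_toRn_le n r
  by_contra h
  obtain ⟨S, hS, hc⟩ := Set.Infinite.exists_subset_card_eq h (C + 1)
  have := hC x S fun μ hμ => hS hμ
  omega

lemma cube_eq_preimage (n : ℕ) :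
    cube n = WithLp.ofLp ⁻¹' (Set.univ.pi fun _ => Set.Icc (-1 / 2 : ℝ) (1 / 2)) := by
  ext x
  simp only [cube, Set.mem_ofPred_eq, Set.mem_preimage, Set.mem_pi, Set.mem_univ, true_imp_iff]

lemma isCompact_cube (n : ℕ) : IsCompact (cube n) := by
  rw [cube_eq_preimage]
  exact (PiLp.homeomorph 2 (fun _ : Fin n => ℝ)).isCompact_preimage.2
    (isCompact_univ_pi fun _ => isCompact_Icc)

lemma measurableSet_cube (n : ℕ) : MeasurableSet (cube n) :=
  (isCompact_cube n).isClosed.measurableSet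

lemma norm_le_of_mem_cube {x : Rn n} (hx : x ∈ cube n) : ‖x‖ ≤ n := by
  refine (EuclideanSpace.norm_eq x).trans_le (Real.sqrt_le_iff.2 ⟨by positivity, ?_⟩)
  have h : ∀ i ∈ Finset.univ, ‖x i‖ ^ 2 ≤ (1 : ℝ) := fun i _ => by
    obtain ⟨hl, hr⟩ := hx i
    rw [Real.norm_eq_abs, sq_abs]
    nlinarith
  calc ∑ i, ‖x i‖ ^ 2 ≤ n := by simpa using Finset.sum_le_sum h
    _ ≤ (n : ℝ) ^ 2 := by exact_mod_cast Nat.le_self_pow two_ne_zero n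

lemma exists_sub_mem_cube (x : Rn n) : ∃ m : Zn n, x - toRn m ∈ cube n := by
  refine ⟨fun i => round (x i), fun i => ?_⟩
  have := abs_le.1 (abs_sub_round (x i))
  simp only [toRn, PiLp.sub_apply, Set.mem_Icc]
  constructor <;> linarith

end Lattice

section TrigonometricSums

lemma integral_Icc_fourierChar (m : ℤ) :
    ∫ x in Set.Icc (-1 / 2 : ℝ) (1 / 2), (𝐞 (x * m) : ℂ) = if m = 0 then 1 else 0 := by
  rw [integral_Icc_eq_integral_Ioc, ← intervalIntegral.integral_of_le (by norm_num)]
  split_ifs with h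
  · subst h; simp; norm_num
  · have hc : (2 * Real.pi * Complex.I * m : ℂ) ≠ 0 := by
      simp [h, Real.pi_ne_zero]
    have hexp : ∀ x : ℝ, (𝐞 (x * m) : ℂ) = Complex.exp ((2 * Real.pi * Complex.I * m) * x) := by
      intro x; rw [fourierChar_eq_exp]; push_cast; ring_nf
    have hper : Complex.exp ((2 * Real.pi * Complex.I * m) * ((1 / 2 : ℝ) : ℂ)) =
        Complex.exp ((2 * Real.pi * Complex.I * m) * ((-1 / 2 : ℝ) : ℂ)) := by
      rw [Complex.exp_eq_exp_iff_exists_int]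
      exact ⟨m, by push_cast; ring⟩
    simp_rw [hexp]
    rw [integral_exp_mul_complex hc, hper, sub_self, zero_div]

lemma fourierChar_inner_toRn_eq_prod (y : Rn n) (τ : Zn n) :
    (𝐞 ⟪y, toRn τ⟫_ℝ : ℂ) = ∏ i, (𝐞 (y i * τ i) : ℂ) := by
  simp_rw [inner_toRn, fourierChar_eq_exp, ← Complex.exp_sum, ← Finset.mul_sum]
  push_cast
  rfl

lemma integral_cube_fourierChar (τ : Zn n) :
    ∫ y in cube n, (𝐞 ⟪y, toRn τ⟫_ℝ : ℂ) = if τ = 0 then 1 else 0 := by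
  simp_rw [fourierChar_inner_toRn_eq_prod]
  rw [cube_eq_preimage, (PiLp.volume_preserving_ofLp (Fin n)).setIntegral_preimage_emb
    (MeasurableEquiv.toLp 2 (Fin n → ℝ)).symm.measurableEmbedding
    (fun x : Fin n → ℝ => ∏ i, (𝐞 (x i * τ i) : ℂ)), volume_pi, Measure.restrict_pi_pi,
    integral_fintype_prod_eq_prod (fun i (x : ℝ) => (𝐞 (x * τ i) : ℂ))]
  simp_rw [integral_Icc_fourierChar]
  split_ifs with h
  · subst h; simp
  · obtain ⟨i, hi⟩ := Function.ne_iff.1 h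
    exact Finset.prod_eq_zero (Finset.mem_univ i) (by simpa using hi)

/-- The trigonometric polynomial `∑_{τ ∈ S} c_τ e^{2πi y·τ}`. -/
def trigSum (S : Finset (Zn n)) (c : Zn n → ℂ) (y : Rn n) : ℂ :=
  ∑ τ ∈ S, c τ * 𝐞 ⟪y, toRn τ⟫_ℝ

@[fun_prop] lemma continuous_trigSum (S : Finset (Zn n)) (c : Zn n → ℂ) :
    Continuous (trigSum S c) := by
  unfold trigSum; fun_prop

lemma trigSum_add_toRn (S : Finset (Zn n)) (c : Zn n → ℂ) (y : Rn n) (m : Zn n) :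
    trigSum S c (y + toRn m) = trigSum S c y := by
  simp only [trigSum, fourierChar_inner_add_toRn]

lemma normSq_trigSum (S : Finset (Zn n)) (c : Zn n → ℂ) (y : Rn n) :
    ((‖trigSum S c y‖ ^ 2 : ℝ) : ℂ) =
      ∑ τ ∈ S, ∑ τ' ∈ S, (c τ * (starRingEnd ℂ) (c τ')) * 𝐞 ⟪y, toRn (τ - τ')⟫_ℝ := by
  rw [Complex.ofReal_pow, ← Complex.mul_conj', trigSum, map_sum, Finset.sum_mul_sum]
  refine Finset.sum_congr rfl fun τ _ => Finset.sum_congr rfl fun τ' _ => ?_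
  rw [map_mul, Circle.starRingEnd_addChar, toRn_sub, inner_sub_right, sub_eq_add_neg,
    fourierChar_add]
  ring

lemma integral_cube_norm_trigSum_sq (S : Finset (Zn n)) (c : Zn n → ℂ) :
    ∫ y in cube n, ‖trigSum S c y‖ ^ 2 = ∑ τ ∈ S, ‖c τ‖ ^ 2 := by
  have hint : ∀ f : Rn n → ℂ, Continuous f → IntegrableOn f (cube n) := fun f hf =>
    hf.continuousOn.integrableOn_compact (isCompact_cube n)
  apply Complex.ofReal_injective
  rw [← integral_complex_ofReal]
  simp_rw [normSq_trigSum]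
  rw [integral_finsetSum _ fun τ _ => hint _ (by fun_prop), Complex.ofReal_sum]
  refine Finset.sum_congr rfl fun τ hτ => ?_
  rw [integral_finsetSum _ fun τ' _ => hint _ (by fun_prop)]
  simp_rw [integral_const_mul, integral_cube_fourierChar, sub_eq_zero]
  simp [hτ, Complex.mul_conj']

lemma lintegral_cube_trigSum_sq (S : Finset (Zn n)) (c : Zn n → ℂ) :
    ∫⁻ y in cube n, ‖trigSum S c y‖ₑ ^ 2 = ∑ τ ∈ S, ‖c τ‖ₑ ^ 2 := by
  have hint : IntegrableOn (fun y => ‖trigSum S c y‖ ^ 2) (cube n) :=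
    (by fun_prop : Continuous _).continuousOn.integrableOn_compact (isCompact_cube n)
  simp_rw [enorm_sq_eq_ofReal]
  rw [← ofReal_integral_eq_lintegral_ofReal hint (.of_forall fun _ => by positivity),
    integral_cube_norm_trigSum_sq, ENNReal.ofReal_sum_of_nonneg fun _ _ => by positivity]

lemma lintegral_translated_cube_trigSum_sq (S : Finset (Zn n)) (c : Zn n → ℂ) (m : Zn n) :
    ∫⁻ y in {y | y - toRn m ∈ cube n}, ‖trigSum S c y‖ₑ ^ 2 = ∑ τ ∈ S, ‖c τ‖ₑ ^ 2 := by
  rw [← lintegral_cube_trigSum_sq]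
  refine Eq.trans (lintegral_congr fun y => ?_)
    ((measurePreserving_sub_right (volume : Measure (Rn n)) (toRn m)).setLIntegral_comp_preimage
      (measurableSet_cube n) (f := fun y => ‖trigSum S c y‖ₑ ^ 2) (by fun_prop))
  rw [← trigSum_add_toRn S c (y - toRn m) m, sub_add_cancel]

/-- The large sieve: a ball is covered by a bounded number of lattice translates of the cube. -/
lemma exists_lintegral_closedBall_trigSum_sq_le (n : ℕ) (r : ℝ) :
    ∃ C : ℕ, ∀ (x : Rn n) (S : Finset (Zn n)) (c : Zn n → ℂ),
      ∫⁻ y in Metric.closedBall x r, ‖trigSum S c y‖ₑ ^ 2 ≤ C * ∑ τ ∈ S, ‖c τ‖ₑ ^ 2 := by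
  obtain ⟨C, hC⟩ := exists_card_le_of_norm_sub_toRn_le n (r + n)
  refine ⟨C, fun x S c => ?_⟩
  set M := (finite_lattice_near x (r + n)).toFinset
  have hcover : Metric.closedBall x r ⊆ ⋃ m : M, {y | y - toRn m.1 ∈ cube n} := fun y hy => by
    obtain ⟨m, hm⟩ := exists_sub_mem_cube y
    have hxm : ‖x - toRn m‖ ≤ r + n := by
      rw [← sub_add_sub_cancel x y]
      exact (norm_add_le _ _).trans
        (add_le_add (mem_closedBall_iff_norm'.1 hy) (norm_le_of_mem_cube hm))
    exact Set.mem_iUnion.2 ⟨⟨m, by simpa [M] using hxm⟩, hm⟩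
  calc ∫⁻ y in Metric.closedBall x r, ‖trigSum S c y‖ₑ ^ 2
      ≤ ∑' m : M, ∫⁻ y in {y | y - toRn m.1 ∈ cube n}, ‖trigSum S c y‖ₑ ^ 2 :=
        (lintegral_mono_set hcover).trans (lintegral_iUnion_le _ _)
    _ = M.card * ∑ τ ∈ S, ‖c τ‖ₑ ^ 2 := by
        simp [lintegral_translated_cube_trigSum_sq]
    _ ≤ C * ∑ τ ∈ S, ‖c τ‖ₑ ^ 2 := by
        gcongr
        exact hC x M fun μ hμ => by simpa [M] using hμ

/-- Bessel's inequality on balls, dual to the large sieve. -/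
lemma exists_bessel (n : ℕ) (r : ℝ) : ∃ C : ℕ, ∀ (x : Rn n) (u : Rn n → ℂ), Integrable u →
    (∀ ξ, u ξ ≠ 0 → ξ ∈ Metric.closedBall x r) →
    ∑' ρ : Zn n, ‖∫ ξ, 𝐞 ⟪ξ, toRn ρ⟫_ℝ * u ξ‖ₑ ^ 2 ≤ C * ∫⁻ ξ, ‖u ξ‖ₑ ^ 2 := by
  obtain ⟨C, hC⟩ := exists_lintegral_closedBall_trigSum_sq_le n r
  refine ⟨C, fun x u hu hsupp => ?_⟩
  rw [ENNReal.tsum_eq_iSup_sum]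
  refine iSup_le fun S => ?_
  set c : Zn n → ℂ := fun ρ => ∫ ξ, 𝐞 ⟪ξ, toRn ρ⟫_ℝ * u ξ
  set E : Rn n → ℂ := trigSum S fun ρ => (starRingEnd ℂ) (c ρ) with hE
  have hdual : ∫ ξ, E ξ * u ξ = ∑ ρ ∈ S, (starRingEnd ℂ) (c ρ) * c ρ := by
    simp_rw [hE, trigSum, Finset.sum_mul, mul_assoc]
    rw [integral_finsetSum _ fun ρ _ => Integrable.const_mul (hu.bdd_mul (c := 1) (by fun_prop)
      (.of_forall fun ξ => (norm_fourierChar _).le)) _]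
    simp_rw [integral_const_mul, c]
  have htop : ∑ ρ ∈ S, ‖c ρ‖ₑ ^ 2 ≠ ⊤ :=
    ENNReal.sum_ne_top.2 fun ρ _ => ENNReal.pow_ne_top enorm_ne_top
  have hle : ∑ ρ ∈ S, ‖c ρ‖ₑ ^ 2 ≤
      (C * ∑ ρ ∈ S, ‖c ρ‖ₑ ^ 2) ^ (1 / 2 : ℝ) * (∫⁻ ξ, ‖u ξ‖ₑ ^ 2) ^ (1 / 2 : ℝ) := by
    calc ∑ ρ ∈ S, ‖c ρ‖ₑ ^ 2
        ≤ ∫⁻ ξ, ‖E ξ * u ξ‖ₑ := by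
          rw [← enorm_sum_conj_mul_self, ← hdual]
          exact enorm_integral_le_lintegral_enorm _
      _ = ∫⁻ ξ in Metric.closedBall x r, ‖E ξ‖ₑ * ‖u ξ‖ₑ := by
          simp_rw [enorm_mul]
          refine (setLIntegral_eq_of_support_subset fun ξ hξ => hsupp ξ ?_).symm
          aesop
      _ ≤ (∫⁻ ξ in Metric.closedBall x r, ‖E ξ‖ₑ ^ 2) ^ (1 / 2 : ℝ) *
            (∫⁻ ξ in Metric.closedBall x r, ‖u ξ‖ₑ ^ 2) ^ (1 / 2 : ℝ) :=
          lintegral_mul_le_sqrt_mul_sqrt _ (by fun_prop) hu.restrict.aestronglyMeasurable.enorm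
      _ ≤ _ := by
          gcongr
          · simpa only [RCLike.enorm_conj] using hC x S fun ρ => (starRingEnd ℂ) (c ρ)
          · exact Measure.restrict_le_self
  refine le_of_sq_le_mul htop ((pow_le_pow_left' hle 2).trans_eq ?_)
  rw [mul_pow, rpow_half_sq, rpow_half_sq]
  ring

end TrigonometricSums

section MatrixNorm

open scoped Pointwise

variable {ι : Type*}

/-- The `ℓ²` norm of the restriction of a family of complex numbers to a finite set of indices. -/
def ell2 (M : Finset ι) (F : ι → ℂ) : ℝ≥0∞ := (∑ i ∈ M, ‖F i‖ₑ ^ 2) ^ (1 / 2 : ℝ)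

lemma ell2_sq (M : Finset ι) (F : ι → ℂ) : ell2 M F ^ 2 = ∑ i ∈ M, ‖F i‖ₑ ^ 2 :=
  rpow_half_sq _

lemma ell2_ne_top (M : Finset ι) (F : ι → ℂ) : ell2 M F ≠ ⊤ :=
  ENNReal.rpow_ne_top_of_nonneg (by norm_num)
    (ENNReal.sum_ne_top.2 fun _ _ => ENNReal.pow_ne_top enorm_ne_top)

lemma ell2_congr {M : Finset ι} {F G : ι → ℂ} (h : ∀ i ∈ M, F i = G i) : ell2 M F = ell2 M G := by
  rw [ell2, ell2, Finset.sum_congr rfl fun i hi => by rw [h i hi]]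

lemma ell2_conj (M : Finset ι) (F : ι → ℂ) :
    ell2 M (fun i => (starRingEnd ℂ) (F i)) = ell2 M F := by
  simp only [ell2, RCLike.enorm_conj]

lemma ell2_mono {M N : Finset ι} (h : M ⊆ N) (F : ι → ℂ) : ell2 M F ≤ ell2 N F := by
  unfold ell2; gcongr

lemma enorm_sum_mul_le_ell2_mul_ell2 (M : Finset ι) (F G : ι → ℂ) :
    ‖∑ i ∈ M, F i * G i‖ₑ ≤ ell2 M F * ell2 M G := by
  refine (enorm_sum_le _ _).trans ?_
  simpa [ell2, enorm_mul] using
    ENNReal.inner_le_Lp_mul_Lq M (‖F ·‖ₑ) (‖G ·‖ₑ) Real.HolderConjugate.two_two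

lemma ell2_eq_ofReal_l2norm {F : Zn n →₀ ℂ} {M : Finset (Zn n)} (hM : F.support ⊆ M) :
    ell2 M F = ENNReal.ofReal (l2norm F) := by
  have hsum : ∑ μ ∈ M, ‖F μ‖ₑ ^ 2 = ENNReal.ofReal (∑ μ ∈ F.support, ‖F μ‖ ^ 2) := by
    rw [ENNReal.ofReal_sum_of_nonneg fun _ _ => by positivity]
    simp_rw [← enorm_sq_eq_ofReal]
    exact (Finset.sum_subset hM fun μ _ hμ => by simp [Finsupp.notMem_support_iff.1 hμ]).symm
  rw [ell2, hsum, l2norm, Real.sqrt_eq_rpow,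
    ENNReal.ofReal_rpow_of_nonneg (by positivity) (by norm_num)]

lemma exists_eq_smul_l2norm_eq_one (F : Zn n →₀ ℂ) :
    ∃ (s : ℂ) (F' : Zn n →₀ ℂ), F = s • F' ∧ ‖s‖ₑ = ell2 F.support F ∧ l2norm F' = 1 := by
  rw [ell2_eq_ofReal_l2norm subset_rfl]
  rcases eq_or_ne F 0 with rfl | hF
  · exact ⟨0, Finsupp.single 0 1, by simp, by simp [l2norm],
      by simp [l2norm]⟩
  · have hpos : 0 < l2norm F := by
      refine Real.sqrt_pos.2 (Finset.sum_pos (fun μ hμ => ?_) (Finsupp.support_nonempty_iff.2 hF))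
      have := Finsupp.mem_support_iff.1 hμ
      positivity
    have hne : (l2norm F : ℂ) ≠ 0 := by exact_mod_cast hpos.ne'
    refine ⟨l2norm F, (l2norm F : ℂ)⁻¹ • F, (smul_inv_smul₀ hne F).symm,
      enorm_ofReal_of_nonneg hpos.le, ?_⟩
    rw [l2norm, Finsupp.support_smul_eq (inv_ne_zero hne)]
    simp only [Finsupp.smul_apply, smul_eq_mul, norm_mul, mul_pow, ← Finset.mul_sum, norm_inv,
      Complex.norm_of_nonneg hpos.le]
    rw [Real.sqrt_mul (by positivity), ← l2norm, Real.sqrt_sq (by positivity),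
      inv_mul_cancel₀ hpos.ne']

lemma trilinearForm_eq_sum_of_support_subset (a : Zn n → Zn n → ℂ) {F G : Zn n →₀ ℂ}
    (H : Zn n →₀ ℂ) {M N : Finset (Zn n)} (hM : F.support ⊆ M) (hN : G.support ⊆ N) :
    trilinearForm a F G H = ∑ μ ∈ M, ∑ ν ∈ N, a μ ν * F μ * G ν * H (μ + ν) := by
  rw [trilinearForm, ← Finset.sum_subset hM]
  · refine Finset.sum_congr rfl fun μ _ => Finset.sum_subset hN fun ν _ hν => ?_
    simp [Finsupp.notMem_support_iff.1 hν]
  · intro μ _ hμ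
    simp [Finsupp.notMem_support_iff.1 hμ]

lemma trilinearForm_smul (a : Zn n → Zn n → ℂ) (s t r : ℂ) (F G H : Zn n →₀ ℂ) :
    trilinearForm a (s • F) (t • G) (r • H) = s * t * r * trilinearForm a F G H := by
  rw [trilinearForm_eq_sum_of_support_subset a _ Finsupp.support_smul Finsupp.support_smul,
    trilinearForm]
  simp only [Finset.mul_sum, Finsupp.smul_apply, smul_eq_mul]
  exact Finset.sum_congr rfl fun _ _ => Finset.sum_congr rfl fun _ _ => by ring

lemma enorm_trilinearForm_le (a : Zn n → Zn n → ℂ) (F G H : Zn n →₀ ℂ) :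
    ‖trilinearForm a F G H‖ₑ ≤
      Bnorm a * (ell2 F.support F * ell2 G.support G * ell2 H.support H) := by
  obtain ⟨s, F', hF, hs, hF'⟩ := exists_eq_smul_l2norm_eq_one F
  obtain ⟨t, G', hG, ht, hG'⟩ := exists_eq_smul_l2norm_eq_one G
  obtain ⟨r, H', hH, hr, hH'⟩ := exists_eq_smul_l2norm_eq_one H
  have hB : ‖trilinearForm a F' G' H'‖ₑ ≤ Bnorm a :=
    le_iSup_of_le F' <| le_iSup_of_le G' <| le_iSup_of_le H' <| le_iSup_of_le hF' <|
      le_iSup_of_le hG' <| le_iSup_of_le hH' le_rfl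
  have hform : trilinearForm a F G H = s * t * r * trilinearForm a F' G' H' := by
    rw [← trilinearForm_smul, ← hF, ← hG, ← hH]
  rw [hform, ← hs, ← ht, ← hr, enorm_mul, enorm_mul, enorm_mul, mul_comm]
  gcongr

lemma enorm_sum_le_Bnorm_mul_ell2 (a : Zn n → Zn n → ℂ) (M N : Finset (Zn n)) (F G H : Zn n → ℂ) :
    ‖∑ μ ∈ M, ∑ ν ∈ N, a μ ν * F μ * G ν * H (μ + ν)‖ₑ ≤
      Bnorm a * (ell2 M F * ell2 N G * ell2 (M + N) H) := by
  let cut (M : Finset (Zn n)) (F : Zn n → ℂ) : Zn n →₀ ℂ := Finsupp.indicator M fun μ _ => F μ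
  have hsupp : ∀ M F, (cut M F).support ⊆ M := fun M F => Finsupp.support_indicator_subset _ _
  have hcut : ∀ M F, ∀ μ ∈ M, cut M F μ = F μ := fun M F μ hμ => Finsupp.indicator_of_mem hμ _
  have hell2 : ∀ M F, ell2 (cut M F).support (cut M F) = ell2 M F := fun M F => by
    rw [ell2_eq_ofReal_l2norm subset_rfl, ← ell2_eq_ofReal_l2norm (hsupp M F),
      ell2_congr (hcut M F)]
  have hform : trilinearForm a (cut M F) (cut N G) (cut (M + N) H) =
      ∑ μ ∈ M, ∑ ν ∈ N, a μ ν * F μ * G ν * H (μ + ν) := by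
    rw [trilinearForm_eq_sum_of_support_subset a _ (hsupp M F) (hsupp N G)]
    refine Finset.sum_congr rfl fun μ hμ => Finset.sum_congr rfl fun ν hν => ?_
    rw [hcut M F μ hμ, hcut N G ν hν, hcut _ H _ (Finset.add_mem_add hμ hν)]
  simpa only [hform, hell2] using enorm_trilinearForm_le a (cut M F) (cut N G) (cut (M + N) H)

/-- The trigonometric polynomial `∑_{μ,ν} a_{μ,ν} F(μ) G(ν) e^{2πi y·(μ+ν)}`, whose `L²(Q)` norm
links the multiplier operator to `Bnorm`. -/
def bilinTrig (a : Zn n → Zn n → ℂ) (M N : Finset (Zn n)) (F G : Zn n → ℂ) (y : Rn n) : ℂ :=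
  ∑ μ ∈ M, ∑ ν ∈ N, a μ ν * F μ * G ν * 𝐞 ⟪y, toRn (μ + ν)⟫_ℝ

/-- The Fourier coefficient of `bilinTrig` at `τ`, a sum over the antidiagonal `μ + ν = τ`. -/
def diagCoeff (a : Zn n → Zn n → ℂ) (M N : Finset (Zn n)) (F G : Zn n → ℂ) (τ : Zn n) : ℂ :=
  ∑ μ ∈ M, ∑ ν ∈ N, if μ + ν = τ then a μ ν * F μ * G ν else 0

lemma sum_diagCoeff_mul (a : Zn n → Zn n → ℂ) (M N : Finset (Zn n)) (F G H : Zn n → ℂ) :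
    ∑ τ ∈ M + N, diagCoeff a M N F G τ * H τ =
      ∑ μ ∈ M, ∑ ν ∈ N, a μ ν * F μ * G ν * H (μ + ν) := by
  simp only [diagCoeff, Finset.sum_mul]
  rw [Finset.sum_comm]
  refine Finset.sum_congr rfl fun μ hμ => ?_
  rw [Finset.sum_comm]
  refine Finset.sum_congr rfl fun ν hν => ?_
  simp only [ite_mul, zero_mul]
  rw [Finset.sum_ite_eq, if_pos (Finset.add_mem_add hμ hν)]

lemma eLpNorm_bilinTrig (a : Zn n → Zn n → ℂ) (M N : Finset (Zn n)) (F G : Zn n → ℂ) :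
    eLpNorm (bilinTrig a M N F G) 2 (volume.restrict (cube n)) =
      ell2 (M + N) (diagCoeff a M N F G) := by
  have htrig : bilinTrig a M N F G = trigSum (M + N) (diagCoeff a M N F G) :=
    funext fun y => (sum_diagCoeff_mul a M N F G fun τ => 𝐞 ⟪y, toRn τ⟫_ℝ).symm
  rw [eLpNorm_two_eq, htrig, lintegral_cube_trigSum_sq, ell2]

lemma eLpNorm_bilinTrig_le (a : Zn n → Zn n → ℂ) (M N : Finset (Zn n)) (F G : Zn n → ℂ) :
    eLpNorm (bilinTrig a M N F G) 2 (volume.restrict (cube n)) ≤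
      Bnorm a * (ell2 M F * ell2 N G) := by
  rw [eLpNorm_bilinTrig]
  have hdual := enorm_sum_le_Bnorm_mul_ell2 a M N F G
    fun τ => (starRingEnd ℂ) (diagCoeff a M N F G τ)
  rw [← sum_diagCoeff_mul a M N F G fun τ => (starRingEnd ℂ) (diagCoeff a M N F G τ),
    ell2_conj] at hdual
  simp_rw [mul_comm (diagCoeff a M N F G _), enorm_sum_conj_mul_self, ← ell2_sq] at hdual
  exact le_of_sq_le_mul (ell2_ne_top _ _) (hdual.trans_eq (by ring))

lemma enorm_trilinearForm_le_eLpNorm_bilinTrig (a : Zn n → Zn n → ℂ) (F G : Zn n →₀ ℂ)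
    {H : Zn n →₀ ℂ} (hH : l2norm H = 1) :
    ‖trilinearForm a F G H‖ₑ ≤
      eLpNorm (bilinTrig a F.support G.support F G) 2 (volume.restrict (cube n)) := by
  set T := F.support + G.support
  have hHT : ell2 T H ≤ 1 := by
    rw [← ENNReal.ofReal_one, ← hH, ← ell2_eq_ofReal_l2norm (Finset.subset_union_left (s₂ := T))]
    exact ell2_mono Finset.subset_union_right _
  rw [eLpNorm_bilinTrig, trilinearForm, ← sum_diagCoeff_mul a F.support G.support F G H]
  exact (enorm_sum_mul_le_ell2_mul_ell2 _ _ _).trans (mul_le_of_le_one_right' hHT)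

end MatrixNorm

section TestFunctions

variable {V : Type*} [NormedAddCommGroup V]

lemma IsTestFunction.exists_support_bound [NormedSpace ℝ V] {Φ : V → ℂ} (hΦ : IsTestFunction Φ) :
    ∃ R : ℝ, ∀ v, Φ v ≠ 0 → ‖v‖ ≤ R := by
  obtain ⟨R, hR⟩ := hΦ.2.isBounded.exists_norm_le
  exact ⟨R, fun v hv => hR v (subset_tsupport _ hv)⟩

lemma IsTestFunction.exists_nnnorm_bound [NormedSpace ℝ V] {Φ : V → ℂ} (hΦ : IsTestFunction Φ) :
    ∃ K : ℝ≥0, ∀ v, ‖Φ v‖₊ ≤ K := by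
  obtain ⟨K, hK⟩ := hΦ.2.exists_bound_of_continuous hΦ.1.continuous
  exact ⟨K.toNNReal, fun v => NNReal.le_toNNReal_of_coe_le (hK v)⟩

lemma IsTestFunction.comp_sub_right [NormedSpace ℝ V] {Φ : V → ℂ} (hΦ : IsTestFunction Φ) (c : V) :
    IsTestFunction fun v => Φ (v - c) :=
  ⟨hΦ.1.comp (contDiff_id.sub contDiff_const), hΦ.2.comp_homeomorph (Homeomorph.subRight c)⟩

variable [InnerProductSpace ℝ V] [FiniteDimensional ℝ V]

lemma isTestFunction_of_support_bound {Φ : V → ℂ} (hΦ : ContDiff ℝ ∞ Φ) {R : ℝ}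
    (hR : ∀ v, Φ v ≠ 0 → ‖v‖ ≤ R) : IsTestFunction Φ :=
  ⟨hΦ, .of_support_subset_isCompact (isCompact_closedBall 0 R) fun v hv => by simpa using hR v hv⟩

lemma exists_cutoff (V : Type*) [NormedAddCommGroup V] [InnerProductSpace ℝ V]
    [FiniteDimensional ℝ V] (r : ℝ) :
    ∃ θ : V → ℂ, IsTestFunction θ ∧ ∀ v, ‖v‖ ≤ r → θ v = 1 := by
  let b : ContDiffBump (0 : V) := ⟨max r 1, max r 1 + 1, by positivity, by linarith⟩
  refine ⟨fun v => b v, ⟨Complex.ofRealCLM.contDiff.comp b.contDiff,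
    b.hasCompactSupport.comp_left Complex.ofReal_zero⟩, fun v hv => ?_⟩
  have hbv : b v = 1 := b.one_of_mem_closedBall (by simp [b, hv])
  simp [hbv]

lemma IsTestFunction.exists_eq_integral_fourierChar [MeasurableSpace V] [BorelSpace V] {ψ : V → ℂ}
    (hψ : IsTestFunction ψ) :
    ∃ W : 𝓢(V, ℂ), ∀ v, ψ v = ∫ w, W w * 𝐞 ⟪w, v⟫_ℝ := by
  set ψ' : 𝓢(V, ℂ) := hψ.2.toSchwartzMap hψ.1
  refine ⟨𝓕 ψ', fun v => ?_⟩
  calc ψ v = (𝓕⁻ (𝓕 ψ') : 𝓢(V, ℂ)) v := by rw [FourierTransform.fourierInv_fourier_eq]; rfl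
    _ = ∫ w, (𝓕 ψ' : 𝓢(V, ℂ)) w * (𝐞 ⟪w, v⟫_ℝ : ℂ) := by
        rw [SchwartzMap.fourierInv_coe, Real.fourierInv_eq]
        simp only [Circle.smul_def, smul_eq_mul, mul_comm]

end TestFunctions

section Separation

/-- The space of triples of frequencies, dual to the variables `(y, ξ, η)`. -/
abbrev Freq (n : ℕ) : Type := PiLp 2 fun _ : Fin 3 => Rn n

lemma norm_freq_le (v : Freq n) : ‖v‖ ≤ ‖v 0‖ + ‖v 1‖ + ‖v 2‖ := by
  rw [PiLp.norm_eq_of_L2, Fin.sum_univ_three]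
  refine Real.sqrt_le_iff.2 ⟨by positivity, ?_⟩
  nlinarith [norm_nonneg (v 0), norm_nonneg (v 1), norm_nonneg (v 2)]

/-- The superposition `∫ W(w) e^{2πi w₀·y} K(w, y) dw`. -/
def superpose (W : 𝓢(Freq n, ℂ)) (K : Freq n → Rn n → ℂ) (y : Rn n) : ℂ :=
  ∫ w, W w * 𝐞 ⟪w 0, y⟫_ℝ * K w y

lemma eLpNorm_superpose_le (W : 𝓢(Freq n, ℂ)) {K : Freq n → Rn n → ℂ}
    (hK : Measurable (Function.uncurry K)) (S : Set (Rn n)) :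
    eLpNorm (superpose W K) 2 (volume.restrict S) ≤
      ∫⁻ w, ‖W w‖ₑ * eLpNorm (K w) 2 (volume.restrict S) := by
  have hW : Continuous fun q : Freq n × Rn n => W q.1 * (𝐞 ⟪q.1 0, q.2⟫_ℝ : ℂ) :=
    (W.continuous.comp continuous_fst).mul (by fun_prop)
  refine (eLpNorm_two_integral_le _ _ (hW.measurable.mul hK)).trans_eq
    (lintegral_congr fun w => ?_)
  rw [← eLpNorm_const_smul]
  exact eLpNorm_congr_norm_ae (.of_forall fun y => by simp)

/-- A separation of the variables `y ∈ Q`, `ξ` and `η` in `e^{2πis y·(ξ+η)} Φ(ξ, η)`: a window `θ`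
and a weight `W` which represent this function as a superposition of products of characters. -/
structure IsSeparation (s : ℝ) (Φ : Rn n × Rn n → ℂ) (W : 𝓢(Freq n, ℂ)) (θ : Rn n → ℂ) : Prop where
  isTestFunction : IsTestFunction θ
  eq_integral : ∀ y ∈ cube n, ∀ ξ η, 𝐞 (s * ⟪y, ξ + η⟫_ℝ) * Φ (ξ, η) =
    θ ξ * θ η * ∫ w, W w * 𝐞 (⟪w 0, y⟫_ℝ + ⟪w 1, ξ⟫_ℝ + ⟪w 2, η⟫_ℝ)

lemma isTestFunction_cutoff_mul {Φ : Rn n × Rn n → ℂ} (hΦ : IsTestFunction Φ) {θ : Rn n → ℂ}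
    (hθ : IsTestFunction θ) (s : ℝ) : IsTestFunction fun v : Freq n =>
      θ (v 0) * 𝐞 (s * ⟪v 0, v 1 + v 2⟫_ℝ) * Φ (v 1, v 2) := by
  obtain ⟨R, hR⟩ := hΦ.exists_support_bound
  obtain ⟨r, hr⟩ := hθ.exists_support_bound
  have hcoord : ∀ i, ContDiff ℝ ∞ fun v : Freq n => v i := fun i =>
    (PiLp.proj 2 (fun _ : Fin 3 => Rn n) i : Freq n →L[ℝ] Rn n).contDiff
  refine isTestFunction_of_support_bound (R := r + R + R) ?_ fun v hv => ?_
  · exact ((hθ.1.comp (hcoord 0)).mul (contDiff_fourierChar.comp (contDiff_const.mul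
      ((hcoord 0).inner ℝ ((hcoord 1).add (hcoord 2)))))).mul
        (hΦ.1.comp ((hcoord 1).prodMk (hcoord 2)))
  · have h0 := hr _ (left_ne_zero_of_mul (left_ne_zero_of_mul hv))
    obtain ⟨h1, h2⟩ := norm_prod_le_iff.1 (hR _ (right_ne_zero_of_mul hv))
    linarith [norm_freq_le v]

lemma exists_isSeparation (s : ℝ) {Φ : Rn n × Rn n → ℂ} (hΦ : IsTestFunction Φ) :
    ∃ W θ, IsSeparation s Φ W θ := by
  obtain ⟨R, hR⟩ := hΦ.exists_support_bound
  obtain ⟨θ, hθ, hθ_one⟩ := exists_cutoff (Rn n) (max R n)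
  obtain ⟨W, hW⟩ := (isTestFunction_cutoff_mul hΦ hθ s).exists_eq_integral_fourierChar
  refine ⟨W, θ, hθ, fun y hy ξ η => ?_⟩
  have hθy : θ y = 1 := hθ_one y (le_max_of_le_right (norm_le_of_mem_cube hy))
  have hinner : ∀ w : Freq n, ⟪w, (WithLp.toLp 2 ![y, ξ, η] : Freq n)⟫_ℝ =
      ⟪w 0, y⟫_ℝ + ⟪w 1, ξ⟫_ℝ + ⟪w 2, η⟫_ℝ := fun w => by
    rw [PiLp.inner_apply, Fin.sum_univ_three]; rfl
  have hWv := hW (WithLp.toLp 2 ![y, ξ, η])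
  simp only [hinner, Matrix.cons_val, hθy, one_mul] at hWv
  rw [← hWv]
  by_cases h : Φ (ξ, η) = 0
  · simp [h]
  · obtain ⟨hξ, hη⟩ := norm_prod_le_iff.1 (hR _ h)
    rw [hθ_one ξ (le_max_of_le_left hξ), hθ_one η (le_max_of_le_left hη), one_mul, one_mul]

end Separation

section Overlap

lemma exists_sum_le_of_support_near_lattice (n : ℕ) (r : ℝ) :
    ∃ C : ℕ, ∀ (x : Rn n) (M : Finset (Zn n)) (g : Zn n → ℝ≥0∞) (B : ℝ≥0∞),
      (∀ μ, g μ ≠ 0 → ‖x - toRn μ‖ ≤ r) → (∀ μ, g μ ≤ B) →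
      ∑ μ ∈ M, g μ ≤ C * B := by
  obtain ⟨C, hC⟩ := exists_card_le_of_norm_sub_toRn_le n r
  refine ⟨C, fun x M g B hg hB => ?_⟩
  have hcard := hC x (M.filter (g · ≠ 0)) fun μ hμ => hg μ (Finset.mem_filter.1 hμ).2
  rw [← Finset.sum_filter_ne_zero]
  refine (Finset.sum_le_card_nsmul _ _ B fun μ _ => hB μ).trans ?_
  rw [nsmul_eq_mul]
  gcongr

lemma exists_enorm_sum_sq_le (n : ℕ) (r : ℝ) : ∃ C : ℕ, ∀ (x : Rn n) (M : Finset (Zn n))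
    (f : Zn n → ℂ), (∀ μ, f μ ≠ 0 → ‖x - toRn μ‖ ≤ r) →
      ‖∑ μ ∈ M, f μ‖ₑ ^ 2 ≤ C * ∑ μ ∈ M, ‖f μ‖ₑ ^ 2 := by
  obtain ⟨C, hC⟩ := exists_card_le_of_norm_sub_toRn_le n r
  refine ⟨C, fun x M f hf => ?_⟩
  have hcard := hC x (M.filter (f · ≠ 0)) fun μ hμ => hf μ (Finset.mem_filter.1 hμ).2
  rw [← Finset.sum_filter_ne_zero]
  refine (enorm_sum_sq_le_card _ _).trans ?_
  gcongr
  exact Finset.filter_subset _ _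

end Overlap

section Packets

variable {θ : Rn n → ℂ}

/-- The wave packet at the lattice point `μ` with window `θ`, modulated by `k`. -/
def packet (θ : Rn n → ℂ) (k : Rn n) (μ : Zn n) (ξ : Rn n) : ℂ :=
  𝐞 ⟪k, ξ - toRn μ⟫_ℝ * θ (ξ - toRn μ)

/-- The pairing of `u` with a packet modulated further by the lattice point `ρ`. -/
def packetCoeff (θ u : Rn n → ℂ) (k : Rn n) (ρ μ : Zn n) : ℂ :=
  ∫ ξ, 𝐞 ⟪ξ, toRn ρ⟫_ℝ * (packet θ k μ ξ * u ξ)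

/-- The linear combination of packets with coefficients `F`. -/
def packetSum (θ : Rn n → ℂ) (k : Rn n) (M : Finset (Zn n)) (F : Zn n → ℂ) (ξ : Rn n) : ℂ :=
  ∑ μ ∈ M, F μ * packet θ k μ ξ

@[simp] lemma enorm_packet (θ : Rn n → ℂ) (k : Rn n) (μ : Zn n) (ξ : Rn n) :
    ‖packet θ k μ ξ‖ₑ = ‖θ (ξ - toRn μ)‖ₑ := by
  simp [packet, enorm_mul]

lemma packet_ne_zero {k : Rn n} {μ : Zn n} {ξ : Rn n} :
    packet θ k μ ξ ≠ 0 ↔ θ (ξ - toRn μ) ≠ 0 := by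
  rw [← enorm_ne_zero, enorm_packet, enorm_ne_zero]

lemma isTestFunction_packet (hθ : IsTestFunction θ) (k : Rn n) (μ : Zn n) :
    IsTestFunction (packet θ k μ) := by
  obtain ⟨hsmooth, hsupp⟩ := hθ.comp_sub_right (toRn μ)
  exact ⟨(contDiff_fourierChar.comp
    (contDiff_const.inner ℝ (contDiff_id.sub contDiff_const))).mul hsmooth, hsupp.mul_left⟩

lemma isTestFunction_packetSum (hθ : IsTestFunction θ) (k : Rn n) (M : Finset (Zn n))
    (F : Zn n → ℂ) : IsTestFunction (packetSum θ k M F) := by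
  obtain ⟨hsmooth, hsupp⟩ := forall_and.1 (isTestFunction_packet hθ k)
  refine ⟨.sum fun μ _ => contDiff_const.mul (hsmooth μ), ?_⟩
  induction M using Finset.cons_induction with
  | empty => exact (funext fun ξ => Finset.sum_empty : packetSum θ k ∅ F = 0) ▸ .zero
  | cons μ M hμ ih =>
    have hcons : packetSum θ k (M.cons μ hμ) F = F μ • packet θ k μ + packetSum θ k M F :=
      funext fun ξ => Finset.sum_cons hμ
    exact hcons ▸ (hsupp μ).smul_left.add ih

lemma integrable_packet_mul (hθ : IsTestFunction θ) {u : Rn n → ℂ} (hu : Integrable u) (k : Rn n)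
    (μ : Zn n) : Integrable fun ξ => packet θ k μ ξ * u ξ := by
  have hpacket := isTestFunction_packet hθ k μ
  obtain ⟨K, hK⟩ := hpacket.exists_nnnorm_bound
  exact hu.bdd_mul hpacket.1.continuous.aestronglyMeasurable (.of_forall hK)

lemma continuous_packetCoeff (hθ : IsTestFunction θ) {u : Rn n → ℂ} (hu : Integrable u)
    (ρ μ : Zn n) : Continuous fun k => packetCoeff θ u k ρ μ := by
  obtain ⟨K, hK⟩ := hθ.exists_nnnorm_bound
  refine continuous_of_dominated (bound := fun ξ => K * ‖u ξ‖) (fun k => ?_)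
    (fun k => .of_forall fun ξ => ?_) (hu.norm.const_mul _) (.of_forall fun ξ => ?_)
  · exact (Continuous.aestronglyMeasurable (by fun_prop)).mul
      (integrable_packet_mul hθ hu k μ).aestronglyMeasurable
  · simp only [packet, norm_mul, norm_fourierChar, one_mul]
    gcongr
    exact hK _
  · unfold packet; fun_prop

lemma exists_sum_enorm_packet_sq_le (hθ : IsTestFunction θ) :
    ∃ C : ℝ≥0, ∀ (k : Rn n) (M : Finset (Zn n)) (ξ : Rn n),
      ∑ μ ∈ M, ‖packet θ k μ ξ‖ₑ ^ 2 ≤ C := by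
  obtain ⟨r, hr⟩ := hθ.exists_support_bound
  obtain ⟨K, hK⟩ := hθ.exists_nnnorm_bound
  obtain ⟨C, hC⟩ := exists_sum_le_of_support_near_lattice n r
  refine ⟨C * K ^ 2, fun k M ξ => ?_⟩
  simp only [enorm_packet]
  push_cast
  refine hC ξ M _ _ (fun μ hμ => hr _ fun h => hμ (by simp [h])) fun μ => ?_
  gcongr
  exact enorm_le_coe.2 (hK _)

lemma exists_tsum_ell2_packetCoeff_sq_le (hθ : IsTestFunction θ) :
    ∃ D : ℝ≥0, ∀ u : Rn n → ℂ, Integrable u → ∀ (k : Rn n) (M : Finset (Zn n)),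
      ∑' ρ, ell2 M (packetCoeff θ u k ρ) ^ 2 ≤ (D * L2norm u) ^ 2 := by
  obtain ⟨r, hr⟩ := hθ.exists_support_bound
  obtain ⟨B, hB⟩ := exists_bessel n r
  obtain ⟨C, hC⟩ := exists_sum_enorm_packet_sq_le hθ
  refine ⟨NNReal.sqrt (B * C), fun u hu k M => ?_⟩
  have hpacket := integrable_packet_mul hθ hu k
  have hbessel : ∀ μ, ∑' ρ, ‖packetCoeff θ u k ρ μ‖ₑ ^ 2 ≤ B * ∫⁻ ξ, ‖packet θ k μ ξ * u ξ‖ₑ ^ 2 :=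
    fun μ => hB (toRn μ) _ (hpacket μ) fun ξ hξ => mem_closedBall_iff_norm.2 <|
      hr _ (packet_ne_zero.1 (left_ne_zero_of_mul hξ))
  simp_rw [ell2_sq]
  calc ∑' ρ, ∑ μ ∈ M, ‖packetCoeff θ u k ρ μ‖ₑ ^ 2
      = ∑ μ ∈ M, ∑' ρ, ‖packetCoeff θ u k ρ μ‖ₑ ^ 2 :=
        Summable.tsum_finsetSum fun _ _ => ENNReal.summable
    _ ≤ ∑ μ ∈ M, B * ∫⁻ ξ, ‖packet θ k μ ξ * u ξ‖ₑ ^ 2 := by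
        gcongr with μ; exact hbessel μ
    _ = B * ∫⁻ ξ, (∑ μ ∈ M, ‖packet θ k μ ξ‖ₑ ^ 2) * ‖u ξ‖ₑ ^ 2 := by
        rw [← Finset.mul_sum, ← lintegral_finsetSum' _
          fun μ _ => (hpacket μ).aestronglyMeasurable.enorm.pow_const 2]
        simp_rw [enorm_mul, mul_pow, Finset.sum_mul]
    _ ≤ B * ∫⁻ ξ, C * ‖u ξ‖ₑ ^ 2 := by
        gcongr with ξ; exact hC k M ξ
    _ = (NNReal.sqrt (B * C) * L2norm u) ^ 2 := by
        rw [lintegral_const_mul' _ _ ENNReal.coe_ne_top, ← eLpNorm_two_sq, mul_pow, L2norm,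
          ← ENNReal.coe_pow, NNReal.sq_sqrt]
        push_cast
        ring

lemma exists_L2norm_packetSum_le (hθ : IsTestFunction θ) :
    ∃ D : ℝ≥0, ∀ (k : Rn n) (M : Finset (Zn n)) (F : Zn n → ℂ),
      L2norm (packetSum θ k M F) ≤ D * ell2 M F := by
  obtain ⟨r, hr⟩ := hθ.exists_support_bound
  obtain ⟨C, hC⟩ := exists_enorm_sum_sq_le n r
  obtain ⟨L, hL⟩ : ∃ L : ℝ≥0, (L : ℝ≥0∞) = ∫⁻ ξ, ‖θ ξ‖ₑ ^ 2 := by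
    refine ⟨_, ENNReal.coe_toNNReal ?_⟩
    rw [← eLpNorm_two_sq]
    exact ENNReal.pow_ne_top (hθ.1.continuous.memLp_of_hasCompactSupport hθ.2).2.ne
  refine ⟨NNReal.sqrt (C * L), fun k M F => eLpNorm_two_le_of_sq_le ?_⟩
  have hmeas : ∀ μ, Measurable fun ξ => ‖F μ * packet θ k μ ξ‖ₑ ^ 2 := fun μ =>
    ((isTestFunction_packet hθ k μ).1.continuous.measurable.const_mul _).enorm.pow_const 2
  calc ∫⁻ ξ, ‖packetSum θ k M F ξ‖ₑ ^ 2
      ≤ ∫⁻ ξ, C * ∑ μ ∈ M, ‖F μ * packet θ k μ ξ‖ₑ ^ 2 :=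
        lintegral_mono fun ξ => hC ξ M _ fun μ hμ =>
          hr _ (packet_ne_zero.1 (right_ne_zero_of_mul hμ))
    _ = C * ∑ μ ∈ M, ∫⁻ ξ, ‖F μ * packet θ k μ ξ‖ₑ ^ 2 := by
        rw [lintegral_const_mul' _ _ (ENNReal.natCast_ne_top C),
          lintegral_finsetSum _ fun μ _ => hmeas μ]
    _ = C * ∑ μ ∈ M, ‖F μ‖ₑ ^ 2 * L := by
        simp_rw [enorm_mul, mul_pow, enorm_packet,
          lintegral_const_mul' _ _ (ENNReal.pow_ne_top enorm_ne_top),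
          lintegral_sub_right_eq_self (fun ξ => ‖θ ξ‖ₑ ^ 2), hL]
    _ = (NNReal.sqrt (C * L) * ell2 M F) ^ 2 := by
        rw [mul_pow, ell2_sq, ← ENNReal.coe_pow, NNReal.sq_sqrt, Finset.mul_sum, Finset.mul_sum]
        push_cast
        exact Finset.sum_congr rfl fun _ _ => by ring

end Packets

section FrequencySide

lemma integral_sum_sum {α ι κ : Type*} [MeasurableSpace α] {m : Measure α} (M : Finset ι)
    (N : Finset κ) (c : ι → κ → ℂ) {g : ι → κ → α → ℂ} (hg : ∀ i j, Integrable (g i j) m) :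
    ∫ x, ∑ i ∈ M, ∑ j ∈ N, c i j * g i j x ∂m = ∑ i ∈ M, ∑ j ∈ N, c i j * ∫ x, g i j x ∂m := by
  rw [integral_finsetSum _ fun i _ => integrable_finsetSum _ fun j _ => (hg i j).const_mul _]
  refine Finset.sum_congr rfl fun i _ => ?_
  rw [integral_finsetSum _ fun j _ => (hg i j).const_mul _]
  simp_rw [integral_const_mul]

/-- The bilinear operator in terms of the Fourier transforms of its arguments. -/
def freqOp (σ : Rn n × Rn n → ℂ) (u v : Rn n → ℂ) (x : Rn n) : ℂ :=
  ∫ p : Rn n × Rn n, 𝐞 ⟪x, p.1 + p.2⟫_ℝ * σ p * u p.1 * v p.2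

lemma bilinearOp_eq_freqOp (σ : Rn n × Rn n → ℂ) (f g : 𝓢(Rn n, ℂ)) :
    bilinearOp σ f g = freqOp σ (𝓕 (f : Rn n → ℂ)) (𝓕 (g : Rn n → ℂ)) := by
  funext x
  simp only [bilinearOp, freqOp, fourierChar_eq_exp]

section Bounded

variable {σ : Rn n × Rn n → ℂ} {u v : Rn n → ℂ} {K : ℝ}

lemma norm_freqOp_integrand_le (hK : ∀ p, ‖σ p‖ ≤ K) (x : Rn n) (p : Rn n × Rn n) :
    ‖𝐞 ⟪x, p.1 + p.2⟫_ℝ * σ p * u p.1 * v p.2‖ ≤ K * ‖u p.1 * v p.2‖ := by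
  rw [mul_assoc, norm_mul, norm_mul, norm_fourierChar, one_mul]
  gcongr
  exact hK p

lemma integrable_freqOp_integrand (hσ : Measurable σ) (hK : ∀ p, ‖σ p‖ ≤ K) (hu : Integrable u)
    (hv : Integrable v) (x : Rn n) :
    Integrable fun p : Rn n × Rn n => 𝐞 ⟪x, p.1 + p.2⟫_ℝ * σ p * u p.1 * v p.2 := by
  refine ((hu.mul_prod hv).norm.const_mul K).mono' ?_
    (.of_forall fun p => norm_freqOp_integrand_le hK x p)
  simp_rw [mul_assoc _ (u _) (v _)]
  exact ((Continuous.measurable (by fun_prop)).mul hσ).aestronglyMeasurable.mul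
    (hu.mul_prod hv).aestronglyMeasurable

lemma continuous_freqOp (hσ : Measurable σ) (hK : ∀ p, ‖σ p‖ ≤ K) (hu : Integrable u)
    (hv : Integrable v) : Continuous (freqOp σ u v) :=
  continuous_of_dominated
    (fun x => (integrable_freqOp_integrand hσ hK hu hv x).aestronglyMeasurable)
    (fun x => .of_forall fun p => norm_freqOp_integrand_le hK x p)
    ((hu.mul_prod hv).norm.const_mul K) (.of_forall fun p => by fun_prop)

end Bounded

/-- The truncation of `sigma a Φ` to the lattice points in `M × M`. -/
def sigmaTrunc (a : Zn n → Zn n → ℂ) (Φ : Rn n × Rn n → ℂ) (M : Finset (Zn n))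
    (p : Rn n × Rn n) : ℂ :=
  ∑ μ ∈ M, ∑ ν ∈ M, a μ ν * Φ (p.1 - toRn μ, p.2 - toRn ν)

variable {Φ : Rn n × Rn n → ℂ} {a : Zn n → Zn n → ℂ}

lemma continuous_sigmaTrunc (hΦ : Continuous Φ) (a : Zn n → Zn n → ℂ) (M : Finset (Zn n)) :
    Continuous (sigmaTrunc a Φ M) := by
  unfold sigmaTrunc; fun_prop

lemma exists_sum_sum_le (n : ℕ) (r : ℝ) : ∃ C : ℝ≥0, ∀ (p : Rn n × Rn n) (M : Finset (Zn n))
    (t : Zn n → Zn n → ℝ≥0∞) (B : ℝ≥0∞),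
    (∀ μ ν, t μ ν ≠ 0 → ‖p.1 - toRn μ‖ ≤ r ∧ ‖p.2 - toRn ν‖ ≤ r) → (∀ μ ν, t μ ν ≤ B) →
      ∑ μ ∈ M, ∑ ν ∈ M, t μ ν ≤ C * B := by
  obtain ⟨C, hC⟩ := exists_sum_le_of_support_near_lattice n r
  refine ⟨C * C, fun p M t B hsupp hB => ?_⟩
  push_cast
  rw [mul_assoc]
  refine hC p.1 M _ _ (fun μ hμ => ?_) fun μ =>
    hC p.2 M _ _ (fun ν hν => (hsupp μ ν hν).2) (hB μ)
  obtain ⟨ν, -, hν⟩ := Finset.exists_ne_zero_of_sum_ne_zero hμ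
  exact (hsupp μ ν hν).1

lemma exists_norm_sigmaTrunc_le (hΦ : IsTestFunction Φ) (ha : IsBoundedMatrix a) :
    ∃ K : ℝ≥0, ∀ M p, ‖sigmaTrunc a Φ M p‖ ≤ K := by
  obtain ⟨R, hR⟩ := hΦ.exists_support_bound
  obtain ⟨K, hK⟩ := hΦ.exists_nnnorm_bound
  obtain ⟨A, hA⟩ := ha
  obtain ⟨C, hC⟩ := exists_sum_sum_le n R
  suffices h : ∃ K : ℝ≥0, ∀ M p, ‖sigmaTrunc a Φ M p‖ₑ ≤ K from
    h.imp fun K hK M p => enorm_le_coe.1 (hK M p)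
  refine ⟨C * (A.toNNReal * K), fun M p => ?_⟩
  push_cast
  calc ‖sigmaTrunc a Φ M p‖ₑ
      ≤ ∑ μ ∈ M, ∑ ν ∈ M, ‖a μ ν * Φ (p.1 - toRn μ, p.2 - toRn ν)‖ₑ :=
        (enorm_sum_le _ _).trans (Finset.sum_le_sum fun μ _ => enorm_sum_le _ _)
    _ ≤ C * (A.toNNReal * K) := by
        refine hC p M _ _ (fun μ ν h => ?_) fun μ ν => ?_
        · exact norm_prod_le_iff.1 (hR _ (right_ne_zero_of_mul (enorm_ne_zero.1 h)))
        · rw [enorm_mul]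
          exact mul_le_mul' (enorm_le_coe.2 (NNReal.le_toNNReal_of_coe_le (hA μ ν)))
            (enorm_le_coe.2 (hK _))

lemma tendsto_sigmaTrunc (hΦ : IsTestFunction Φ) (a : Zn n → Zn n → ℂ) (p : Rn n × Rn n) :
    Filter.Tendsto (fun M => sigmaTrunc a Φ M p) Filter.atTop (nhds (sigma a Φ p)) := by
  obtain ⟨R, hR⟩ := hΦ.exists_support_bound
  have hsum : Summable fun m : Zn n × Zn n =>
      a m.1 m.2 * Φ (p.1 - toRn m.1, p.2 - toRn m.2) :=
    summable_of_hasFiniteSupport <|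
      ((finite_lattice_near p.1 R).prod (finite_lattice_near p.2 R)).subset fun m hm =>
        norm_prod_le_iff.1 (hR _ (right_ne_zero_of_mul hm))
  have hdiag : Filter.Tendsto (fun M : Finset (Zn n) => M ×ˢ M) Filter.atTop Filter.atTop :=
    Filter.tendsto_finsetProd_atTop.comp Filter.tendsto_atTop_diagonal
  refine (Filter.Tendsto.comp hsum.hasSum hdiag).congr fun M => ?_
  simp only [Function.comp, sigmaTrunc, Finset.sum_product]

lemma measurable_sigma (hΦ : IsTestFunction Φ) (a : Zn n → Zn n → ℂ) : Measurable (sigma a Φ) :=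
  measurable_of_tendsto_metrizable' Filter.atTop
    (fun M => (continuous_sigmaTrunc hΦ.1.continuous a M).measurable)
    (tendsto_pi_nhds.2 fun p => tendsto_sigmaTrunc hΦ a p)

lemma exists_norm_sigma_le (hΦ : IsTestFunction Φ) (ha : IsBoundedMatrix a) :
    ∃ K : ℝ≥0, ∀ p, ‖sigma a Φ p‖ ≤ K := by
  obtain ⟨K, hK⟩ := exists_norm_sigmaTrunc_le hΦ ha
  exact ⟨K, fun p => le_of_tendsto (tendsto_sigmaTrunc hΦ a p).norm (.of_forall fun M => hK M p)⟩

lemma freqOp_sigmaTrunc (hΦ : IsTestFunction Φ) (a : Zn n → Zn n → ℂ) (M : Finset (Zn n))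
    {u v : Rn n → ℂ} (hu : Integrable u) (hv : Integrable v) (x : Rn n) :
    freqOp (sigmaTrunc a Φ M) u v x = ∑ μ ∈ M, ∑ ν ∈ M,
      a μ ν * freqOp (fun p => Φ (p.1 - toRn μ, p.2 - toRn ν)) u v x := by
  obtain ⟨K, hK⟩ := hΦ.exists_nnnorm_bound
  have hcont := hΦ.1.continuous
  unfold freqOp
  rw [← integral_sum_sum M M a fun μ ν => integrable_freqOp_integrand
    (σ := fun p => Φ (p.1 - toRn μ, p.2 - toRn ν)) (Continuous.measurable (by fun_prop))
    (fun p => hK _) hu hv x]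
  simp only [sigmaTrunc, Finset.mul_sum, Finset.sum_mul]
  congr! 4
  ring

lemma tendsto_freqOp_sigmaTrunc (hΦ : IsTestFunction Φ) (ha : IsBoundedMatrix a) {u v : Rn n → ℂ}
    (hu : Integrable u) (hv : Integrable v) (x : Rn n) :
    Filter.Tendsto (fun M => freqOp (sigmaTrunc a Φ M) u v x) Filter.atTop
      (nhds (freqOp (sigma a Φ) u v x)) := by
  obtain ⟨K, hK⟩ := exists_norm_sigmaTrunc_le hΦ ha
  refine tendsto_integral_filter_of_dominated_convergence (fun p => K * ‖u p.1 * v p.2‖)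
    (.of_forall fun M => (integrable_freqOp_integrand
      (continuous_sigmaTrunc hΦ.1.continuous a M).measurable (hK M) hu hv x).aestronglyMeasurable)
    (.of_forall fun M => .of_forall fun p => norm_freqOp_integrand_le (hK M) x p)
    ((hu.mul_prod hv).norm.const_mul K) (.of_forall fun p => ?_)
  exact ((tendsto_const_nhds.mul (tendsto_sigmaTrunc hΦ a p)).mul_const _).mul_const _

end FrequencySide

section PacketSeparation

variable {s : ℝ} {Φ : Rn n × Rn n → ℂ} {W : 𝓢(Freq n, ℂ)} {θ : Rn n → ℂ} {y : Rn n}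

lemma IsSeparation.integral_packet_mul_packet (h : IsSeparation s Φ W θ) (hy : y ∈ cube n)
    (μ ν : Zn n) (ξ η : Rn n) :
    ∫ w, W w * 𝐞 ⟪w 0, y⟫_ℝ * (packet θ (w 1) μ ξ * packet θ (w 2) ν η) =
      𝐞 (s * ⟪y, ξ - toRn μ + (η - toRn ν)⟫_ℝ) * Φ (ξ - toRn μ, η - toRn ν) := by
  rw [h.eq_integral y hy, ← integral_const_mul]
  congr! 2
  simp only [packet, fourierChar_add]
  ring

lemma integrable_packet_kernel (W : 𝓢(Freq n, ℂ)) (y : Rn n) (μ ν : Zn n)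
    {B : Rn n × Rn n → ℂ}
    (hB : Integrable fun p => θ (p.1 - toRn μ) * θ (p.2 - toRn ν) * B p) :
    Integrable (Function.uncurry fun (p : Rn n × Rn n) w => W w * 𝐞 ⟪w 0, y⟫_ℝ *
      (packet θ (w 1) μ p.1 * packet θ (w 2) ν p.2 * B p)) (volume.prod volume) := by
  have hbdd := (hB.mul_prod (W.integrable (μ := volume))).bdd_mul (c := 1) (f := fun q =>
    (𝐞 (⟪q.2 0, y⟫_ℝ + ⟪q.2 1, q.1.1 - toRn μ⟫_ℝ + ⟪q.2 2, q.1.2 - toRn ν⟫_ℝ) : ℂ))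
    (Continuous.aestronglyMeasurable (by fun_prop)) (.of_forall fun q => (norm_fourierChar _).le)
  refine hbdd.congr (.of_forall fun q => ?_)
  simp only [packet, fourierChar_add, Function.uncurry]
  ring

lemma IsSeparation.integral_sum_packet_mul_packet (h : IsSeparation s Φ W θ) (hy : y ∈ cube n)
    (M N : Finset (Zn n)) (c : Zn n → Zn n → ℂ) {B : Rn n × Rn n → ℂ}
    (hB : ∀ μ ν, Integrable fun p => θ (p.1 - toRn μ) * θ (p.2 - toRn ν) * B p) :
    ∫ w, W w * 𝐞 ⟪w 0, y⟫_ℝ * ∑ μ ∈ M, ∑ ν ∈ N,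
        c μ ν * ∫ p, packet θ (w 1) μ p.1 * packet θ (w 2) ν p.2 * B p =
      ∑ μ ∈ M, ∑ ν ∈ N, c μ ν * ∫ p, 𝐞 (s * ⟪y, p.1 - toRn μ + (p.2 - toRn ν)⟫_ℝ) *
        Φ (p.1 - toRn μ, p.2 - toRn ν) * B p := by
  have hkernel := fun μ ν => integrable_packet_kernel W y μ ν (hB μ ν)
  calc _ = ∫ w, ∑ μ ∈ M, ∑ ν ∈ N, c μ ν * ∫ p, W w * 𝐞 ⟪w 0, y⟫_ℝ *
          (packet θ (w 1) μ p.1 * packet θ (w 2) ν p.2 * B p) := by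
        simp_rw [integral_const_mul, Finset.mul_sum, mul_left_comm (W _ * _)]
    _ = ∑ μ ∈ M, ∑ ν ∈ N, c μ ν * ∫ p, (∫ w, W w * 𝐞 ⟪w 0, y⟫_ℝ *
          (packet θ (w 1) μ p.1 * packet θ (w 2) ν p.2)) * B p := by
        refine (integral_sum_sum M N c fun μ ν => (hkernel μ ν).integral_prod_right).trans ?_
        refine Finset.sum_congr rfl fun μ _ => Finset.sum_congr rfl fun ν _ => ?_
        refine congrArg (c μ ν * ·) ((integral_integral_swap (hkernel μ ν)).symm.trans ?_)
        simp_rw [← mul_assoc, integral_mul_const]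
    _ = _ := by simp_rw [h.integral_packet_mul_packet hy]

end PacketSeparation

section UpperBound

variable {Φ : Rn n × Rn n → ℂ} {W : 𝓢(Freq n, ℂ)} {θ u v : Rn n → ℂ} {y : Rn n}

lemma fourierChar_inner_add_toRn_add (y ξ η : Rn n) (ρ μ ν : Zn n) :
    (𝐞 ⟪y + toRn ρ, ξ + η⟫_ℝ : ℂ) = 𝐞 ⟪y, toRn (μ + ν)⟫_ℝ *
      𝐞 (1 * ⟪y, ξ - toRn μ + (η - toRn ν)⟫_ℝ) * (𝐞 ⟪ξ, toRn ρ⟫_ℝ * 𝐞 ⟪η, toRn ρ⟫_ℝ) := by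
  simp only [← fourierChar_add, real_inner_comm (toRn ρ)]
  congr 2
  simp only [toRn_add, inner_add_right, inner_add_left, inner_sub_right]
  ring

lemma packetCoeff_mul_packetCoeff (θ u v : Rn n → ℂ) (k l : Rn n) (ρ μ ν : Zn n) :
    packetCoeff θ u k ρ μ * packetCoeff θ v l ρ ν = ∫ p : Rn n × Rn n,
      packet θ k μ p.1 * packet θ l ν p.2 *
        (𝐞 ⟪p.1, toRn ρ⟫_ℝ * u p.1 * (𝐞 ⟪p.2, toRn ρ⟫_ℝ * v p.2)) := by
  rw [packetCoeff, packetCoeff, ← integral_prod_mul]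
  congr! 2
  ring

lemma integrable_window_mul_window (hθ : IsTestFunction θ) (hu : Integrable u) (hv : Integrable v)
    (ρ μ ν : Zn n) : Integrable fun p : Rn n × Rn n => θ (p.1 - toRn μ) * θ (p.2 - toRn ν) *
      (𝐞 ⟪p.1, toRn ρ⟫_ℝ * u p.1 * (𝐞 ⟪p.2, toRn ρ⟫_ℝ * v p.2)) := by
  have hfactor : ∀ {u : Rn n → ℂ}, Integrable u → ∀ μ : Zn n,
      Integrable fun ξ => θ (ξ - toRn μ) * (𝐞 ⟪ξ, toRn ρ⟫_ℝ * u ξ) := fun hu μ => by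
    simpa [packet] using integrable_packet_mul hθ
      (hu.bdd_mul (c := 1) (f := fun ξ => (𝐞 ⟪ξ, toRn ρ⟫_ℝ : ℂ)) (by fun_prop)
        (.of_forall fun ξ => (norm_fourierChar _).le)) 0 μ
  exact ((hfactor hu μ).mul_prod (hfactor hv ν)).congr (.of_forall fun p => by ring)

lemma IsSeparation.freqOp_sigmaTrunc_add_toRn (h : IsSeparation 1 Φ W θ) (hΦ : IsTestFunction Φ)
    (a : Zn n → Zn n → ℂ) (M : Finset (Zn n)) (hu : Integrable u) (hv : Integrable v)
    (hy : y ∈ cube n) (ρ : Zn n) :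
    freqOp (sigmaTrunc a Φ M) u v (y + toRn ρ) = superpose W (fun w =>
      bilinTrig a M M (packetCoeff θ u (w 1) ρ) (packetCoeff θ v (w 2) ρ)) y := by
  calc freqOp (sigmaTrunc a Φ M) u v (y + toRn ρ)
      = ∑ μ ∈ M, ∑ ν ∈ M, a μ ν * 𝐞 ⟪y, toRn (μ + ν)⟫_ℝ *
          ∫ p : Rn n × Rn n, 𝐞 (1 * ⟪y, p.1 - toRn μ + (p.2 - toRn ν)⟫_ℝ) *
            Φ (p.1 - toRn μ, p.2 - toRn ν) *
              (𝐞 ⟪p.1, toRn ρ⟫_ℝ * u p.1 * (𝐞 ⟪p.2, toRn ρ⟫_ℝ * v p.2)) := by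
        rw [freqOp_sigmaTrunc hΦ a M hu hv]
        refine Finset.sum_congr rfl fun μ _ => Finset.sum_congr rfl fun ν _ => ?_
        rw [freqOp, mul_assoc, ← integral_const_mul (𝐞 ⟪y, toRn (μ + ν)⟫_ℝ : ℂ)]
        simp only [fourierChar_inner_add_toRn_add y _ _ ρ μ ν]
        congr! 3
        ring
    _ = superpose W (fun w =>
          bilinTrig a M M (packetCoeff θ u (w 1) ρ) (packetCoeff θ v (w 2) ρ)) y := by
        rw [← h.integral_sum_packet_mul_packet hy M M _
          (integrable_window_mul_window h.isTestFunction hu hv ρ)]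
        simp only [superpose, bilinTrig, ← packetCoeff_mul_packetCoeff]
        congr! 5
        ring

lemma measurable_bilinTrig_packetCoeff (hθ : IsTestFunction θ) (a : Zn n → Zn n → ℂ)
    (M : Finset (Zn n)) (hu : Integrable u) (hv : Integrable v) (ρ : Zn n) :
    Measurable (Function.uncurry fun w : Freq n =>
      bilinTrig a M M (packetCoeff θ u (w 1) ρ) (packetCoeff θ v (w 2) ρ)) := by
  have hcoeff : ∀ {u : Rn n → ℂ}, Integrable u → ∀ (i : Fin 3) (μ : Zn n),
      Continuous fun q : Freq n × Rn n => packetCoeff θ u (q.1 i) ρ μ := fun hu i μ =>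
    (continuous_packetCoeff hθ hu ρ μ).comp
      (by fun_prop : Continuous fun q : Freq n × Rn n => q.1 i)
  exact Continuous.measurable <| continuous_finsetSum _ fun μ _ => continuous_finsetSum _ fun ν _ =>
    ((continuous_const.mul (hcoeff hu 1 μ)).mul (hcoeff hv 2 ν)).mul (by fun_prop)

lemma measurable_ell2_packetCoeff (hθ : IsTestFunction θ) (M : Finset (Zn n)) (hu : Integrable u)
    (ρ : Zn n) : Measurable fun k => ell2 M (packetCoeff θ u k ρ) :=
  (Finset.measurable_fun_sum _ fun μ _ =>
    (continuous_packetCoeff hθ hu ρ μ).measurable.enorm.pow_const 2).pow_const _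

lemma amalgamNorm_one_eq (p : ℝ≥0∞) (f : Rn n → ℂ) : amalgamNorm p 1 f =
    ∑' ρ : Zn n, eLpNorm (fun x => f (x + toRn ρ)) p (volume.restrict (cube n)) := by
  rw [amalgamNorm, eLpNorm_one_eq_lintegral_enorm, lintegral_count]
  simp only [enorm_eq_self]

lemma IsSeparation.amalgamNorm_freqOp_sigmaTrunc_le (h : IsSeparation 1 Φ W θ)
    (hΦ : IsTestFunction Φ) (a : Zn n → Zn n → ℂ) (M : Finset (Zn n)) (hu : Integrable u)
    (hv : Integrable v) :
    amalgamNorm 2 1 (freqOp (sigmaTrunc a Φ M) u v) ≤ ∫⁻ w, ‖W w‖ₑ * (Bnorm a * ∑' ρ,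
      ell2 M (packetCoeff θ u (w 1) ρ) * ell2 M (packetCoeff θ v (w 2) ρ)) := by
  have hθ := h.isTestFunction
  have hmeas : ∀ ρ, Measurable fun w : Freq n => ‖W w‖ₑ * (Bnorm a *
      (ell2 M (packetCoeff θ u (w 1) ρ) * ell2 M (packetCoeff θ v (w 2) ρ))) := fun ρ =>
    W.continuous.measurable.enorm.mul (.const_mul
      (((measurable_ell2_packetCoeff hθ M hu ρ).comp (by fun_prop)).mul
        ((measurable_ell2_packetCoeff hθ M hv ρ).comp (by fun_prop))) _)
  simp_rw [amalgamNorm_one_eq, ← ENNReal.tsum_mul_left]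
  rw [lintegral_tsum fun ρ => (hmeas ρ).aemeasurable]
  refine ENNReal.tsum_le_tsum fun ρ => ?_
  rw [eLpNorm_congr_ae ((ae_restrict_mem (measurableSet_cube n)).mono fun y hy =>
    h.freqOp_sigmaTrunc_add_toRn hΦ a M hu hv hy ρ)]
  refine (eLpNorm_superpose_le W (measurable_bilinTrig_packetCoeff hθ a M hu hv ρ) _).trans ?_
  gcongr with w
  exact eLpNorm_bilinTrig_le a M M _ _

lemma exists_coe_eq_lintegral_enorm (W : 𝓢(Freq n, ℂ)) : ∃ I : ℝ≥0, (I : ℝ≥0∞) = ∫⁻ w, ‖W w‖ₑ :=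
  ⟨_, ENNReal.coe_toNNReal W.integrable.2.ne⟩

lemma exists_amalgamNorm_freqOp_sigmaTrunc_le (hΦ : IsTestFunction Φ) :
    ∃ c : ℝ≥0, ∀ (a : Zn n → Zn n → ℂ) (M : Finset (Zn n)) (u v : Rn n → ℂ), Integrable u →
      Integrable v → amalgamNorm 2 1 (freqOp (sigmaTrunc a Φ M) u v) ≤
        c * Bnorm a * (L2norm u * L2norm v) := by
  obtain ⟨W, θ, h⟩ := exists_isSeparation 1 hΦ
  obtain ⟨D, hD⟩ := exists_tsum_ell2_packetCoeff_sq_le h.isTestFunction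
  obtain ⟨I, hI⟩ := exists_coe_eq_lintegral_enorm W
  refine ⟨I * D ^ 2, fun a M u v hu hv => ?_⟩
  have hsqrt : ∀ {u : Rn n → ℂ}, Integrable u → ∀ k,
      (∑' ρ, ell2 M (packetCoeff θ u k ρ) ^ 2) ^ (1 / 2 : ℝ) ≤ D * L2norm u := fun hu k =>
    (ENNReal.rpow_le_rpow (hD _ hu k M) (by norm_num)).trans_eq (sq_rpow_half _)
  calc amalgamNorm 2 1 (freqOp (sigmaTrunc a Φ M) u v)
      ≤ ∫⁻ w, ‖W w‖ₑ * (Bnorm a * ∑' ρ,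
          ell2 M (packetCoeff θ u (w 1) ρ) * ell2 M (packetCoeff θ v (w 2) ρ)) :=
        h.amalgamNorm_freqOp_sigmaTrunc_le hΦ a M hu hv
    _ ≤ ∫⁻ w, ‖W w‖ₑ * (Bnorm a * (D * L2norm u * (D * L2norm v))) := by
        gcongr with w
        exact (tsum_mul_le_sqrt_mul_sqrt _ _).trans (mul_le_mul' (hsqrt hu _) (hsqrt hv _))
    _ = (I * D ^ 2 : ℝ≥0) * Bnorm a * (L2norm u * L2norm v) := by
        rw [lintegral_mul_const _ W.continuous.measurable.enorm, ← hI]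
        push_cast
        ring

lemma L2norm_fourier (f : 𝓢(Rn n, ℂ)) : L2norm (𝓕 (f : Rn n → ℂ)) = L2norm f := by
  have hnorm : ∀ g : 𝓢(Rn n, ℂ), L2norm g = ENNReal.ofReal ‖g.toLp 2 volume‖ := fun g => by
    rw [SchwartzMap.norm_toLp, ENNReal.ofReal_toReal (g.memLp 2 volume).2.ne, L2norm]
  rw [hnorm f, ← SchwartzMap.fourier_coe, hnorm (𝓕 f), ← SchwartzMap.toLp_fourier_eq f,
    Lp.norm_fourier_eq]

lemma amalgamNorm_one_le_of_tendsto {p : ℝ≥0∞} {f : ℕ → Rn n → ℂ} {g : Rn n → ℂ}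
    (hf : ∀ N, Continuous (f N))
    (hlim : ∀ x, Filter.Tendsto (fun N => f N x) Filter.atTop (nhds (g x))) {K : ℝ≥0∞}
    (hK : ∀ N, amalgamNorm p 1 (f N) ≤ K) : amalgamNorm p 1 g ≤ K := by
  simp only [amalgamNorm_one_eq] at hK ⊢
  calc ∑' ρ : Zn n, eLpNorm (fun x => g (x + toRn ρ)) p (volume.restrict (cube n))
      ≤ ∑' ρ : Zn n, Filter.liminf (fun N => eLpNorm (fun x => f N (x + toRn ρ)) p
          (volume.restrict (cube n))) Filter.atTop :=
        ENNReal.tsum_le_tsum fun ρ => Lp.eLpNorm_lim_le_liminf_eLpNorm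
          (fun N => ((hf N).comp (continuous_add_const _)).aestronglyMeasurable) _
          (.of_forall fun x => hlim _)
    _ ≤ Filter.liminf (fun N => ∑' ρ : Zn n, eLpNorm (fun x => f N (x + toRn ρ)) p
          (volume.restrict (cube n))) Filter.atTop := by
        simp only [← lintegral_count]
        exact lintegral_liminf_le fun N => measurable_of_countable _
    _ ≤ K := (Filter.liminf_le_liminf (.of_forall hK)).trans_eq (Filter.liminf_const K)

lemma multiplierNorm_sigma_le (hΦ : IsTestFunction Φ) :
    ∃ c : ℝ≥0, 0 < c ∧ ∀ a : Zn n → Zn n → ℂ, IsBoundedMatrix a →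
      multiplierNorm L2norm L2norm (amalgamNorm 2 1) (sigma a Φ) ≤ c * Bnorm a := by
  obtain ⟨c, hc⟩ := exists_amalgamNorm_freqOp_sigmaTrunc_le hΦ
  refine ⟨c + 1, by positivity, fun a ha => ?_⟩
  refine iSup_le fun f => iSup_le fun g => iSup_le fun hf => iSup_le fun hg => ?_
  obtain ⟨M, hM⟩ := Filter.exists_seq_tendsto (Filter.atTop : Filter (Finset (Zn n)))
  obtain ⟨K, hK⟩ := exists_norm_sigmaTrunc_le hΦ ha
  have hint : ∀ f : 𝓢(Rn n, ℂ), Integrable (𝓕 (f : Rn n → ℂ)) := fun f => (𝓕 f).integrable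
  rw [bilinearOp_eq_freqOp]
  refine amalgamNorm_one_le_of_tendsto
    (fun N => continuous_freqOp (continuous_sigmaTrunc hΦ.1.continuous a (M N)).measurable
      (hK (M N)) (hint f) (hint g))
    (fun x => (tendsto_freqOp_sigmaTrunc hΦ ha (hint f) (hint g) x).comp hM) fun N => ?_
  refine (hc a (M N) _ _ (hint f) (hint g)).trans ?_
  rw [L2norm_fourier, L2norm_fourier, hf, hg, mul_one, mul_one]
  gcongr
  exact le_self_add

end UpperBound

section LowerBound

variable {Φ Θ : Rn n × Rn n → ℂ} {W : 𝓢(Freq n, ℂ)} {θ : Rn n → ℂ} {y : Rn n}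

lemma exists_schwartzMap_ne_zero (n : ℕ) : ∃ f : 𝓢(Rn n, ℂ), f ≠ 0 := by
  obtain ⟨θ, hθ, hθ_one⟩ := exists_cutoff (Rn n) 0
  refine ⟨hθ.2.toSchwartzMap hθ.1, fun h => one_ne_zero (α := ℂ) ?_⟩
  rw [← hθ_one 0 norm_zero.le]
  exact DFunLike.congr_fun h 0

lemma L2norm_ne_top (f : 𝓢(Rn n, ℂ)) : L2norm f ≠ ⊤ := (f.memLp 2 volume).2.ne

lemma L2norm_smul (s : ℝ) (f : 𝓢(Rn n, ℂ)) : L2norm (s • f : 𝓢(Rn n, ℂ)) = ‖s‖ₑ * L2norm f :=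
  eLpNorm_const_smul s (f : Rn n → ℂ) 2 volume

lemma L2norm_eq_zero_iff {f : 𝓢(Rn n, ℂ)} : L2norm f = 0 ↔ f = 0 := by
  rw [L2norm, eLpNorm_eq_zero_iff f.continuous.aestronglyMeasurable two_ne_zero,
    f.continuous.ae_eq_iff_eq volume continuous_zero]
  exact DFunLike.coe_injective.eq_iff' rfl

lemma L2norm_inv_smul_self {f : 𝓢(Rn n, ℂ)} (hf : f ≠ 0) :
    L2norm ((L2norm f).toReal⁻¹ • f : 𝓢(Rn n, ℂ)) = 1 := by
  have h0 : L2norm f ≠ 0 := L2norm_eq_zero_iff.not.2 hf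
  rw [L2norm_smul, enorm_inv (ENNReal.toReal_ne_zero.2 ⟨h0, L2norm_ne_top f⟩),
    Real.enorm_of_nonneg ENNReal.toReal_nonneg, ENNReal.ofReal_toReal (L2norm_ne_top f),
    ENNReal.inv_mul_cancel h0 (L2norm_ne_top f)]

lemma exists_eq_L2norm_smul (f : 𝓢(Rn n, ℂ)) :
    ∃ g : 𝓢(Rn n, ℂ), L2norm g = 1 ∧ f = (L2norm f).toReal • g := by
  obtain rfl | hf := eq_or_ne f 0
  · obtain ⟨f, hf⟩ := exists_schwartzMap_ne_zero n
    exact ⟨_, L2norm_inv_smul_self hf, by rw [L2norm_eq_zero_iff.2 rfl]; simp⟩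
  · have h0 : (L2norm f).toReal ≠ 0 :=
      ENNReal.toReal_ne_zero.2 ⟨L2norm_eq_zero_iff.not.2 hf, L2norm_ne_top f⟩
    exact ⟨_, L2norm_inv_smul_self hf, (smul_inv_smul₀ h0 f).symm⟩

lemma bilinearOp_smul_smul (σ : Rn n × Rn n → ℂ) (s t : ℝ) (f g : 𝓢(Rn n, ℂ)) :
    bilinearOp σ (s • f) (t • g) = (s * t) • bilinearOp σ f g := by
  ext x
  simp only [bilinearOp_eq_freqOp, ← SchwartzMap.fourier_coe, FourierTransform.fourier_smul,
    freqOp, Pi.smul_apply, smul_apply, Complex.real_smul]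
  rw [← integral_const_mul]
  congr! 2
  push_cast
  ring

lemma eLpNorm_cube_le_amalgamNorm_top (p : ℝ≥0∞) (f : Rn n → ℂ) :
    eLpNorm f p (volume.restrict (cube n)) ≤ amalgamNorm p ⊤ f := by
  rw [amalgamNorm, eLpNorm_exponent_top, eLpNormEssSup, essSup_count]
  refine le_iSup_of_le 0 ?_
  simp only [toRn_zero, add_zero, enorm_eq_self, le_refl]

lemma eLpNorm_bilinearOp_le (σ : Rn n × Rn n → ℂ) (f g : 𝓢(Rn n, ℂ)) :
    eLpNorm (bilinearOp σ f g) 2 (volume.restrict (cube n)) ≤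
      L2norm f * L2norm g * multiplierNorm L2norm L2norm (amalgamNorm 2 ⊤) σ := by
  have henorm : ∀ f : 𝓢(Rn n, ℂ), ‖(L2norm f).toReal‖ₑ = L2norm f := fun f => by
    rw [Real.enorm_of_nonneg ENNReal.toReal_nonneg, ENNReal.ofReal_toReal (L2norm_ne_top f)]
  obtain ⟨f', hf', hf⟩ := exists_eq_L2norm_smul f
  obtain ⟨g', hg', hg⟩ := exists_eq_L2norm_smul g
  calc eLpNorm (bilinearOp σ f g) 2 (volume.restrict (cube n))
      = L2norm f * L2norm g * eLpNorm (bilinearOp σ f' g') 2 (volume.restrict (cube n)) := by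
        conv_lhs => rw [hf, hg]
        rw [bilinearOp_smul_smul, eLpNorm_const_smul, enorm_mul, henorm, henorm]
    _ ≤ L2norm f * L2norm g * multiplierNorm L2norm L2norm (amalgamNorm 2 ⊤) σ := by
        gcongr
        exact (eLpNorm_cube_le_amalgamNorm_top 2 _).trans <|
          le_iSup₂_of_le f' g' <| le_iSup₂_of_le hf' hg' le_rfl

lemma IsTestFunction.exists_fourier_eq {u : Rn n → ℂ} (hu : IsTestFunction u) :
    ∃ f : 𝓢(Rn n, ℂ), 𝓕 (f : Rn n → ℂ) = u :=
  ⟨𝓕⁻ (hu.2.toSchwartzMap hu.1), by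
    rw [← SchwartzMap.fourier_coe, FourierTransform.fourier_fourierInv_eq]; rfl⟩

lemma eLpNorm_freqOp_le (σ : Rn n × Rn n → ℂ) {u v : Rn n → ℂ} (hu : IsTestFunction u)
    (hv : IsTestFunction v) : eLpNorm (freqOp σ u v) 2 (volume.restrict (cube n)) ≤
      L2norm u * L2norm v * multiplierNorm L2norm L2norm (amalgamNorm 2 ⊤) σ := by
  obtain ⟨f, rfl⟩ := hu.exists_fourier_eq
  obtain ⟨g, rfl⟩ := hv.exists_fourier_eq
  rw [← bilinearOp_eq_freqOp, L2norm_fourier, L2norm_fourier]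
  exact eLpNorm_bilinearOp_le σ f g

lemma IsTestFunction.integrable_comp_sub_toRn (hΘ : IsTestFunction Θ) (μ ν : Zn n) :
    Integrable fun p : Rn n × Rn n => Θ (p.1 - toRn μ, p.2 - toRn ν) :=
  have hshift := hΘ.comp_sub_right (toRn μ, toRn ν)
  hshift.1.continuous.integrable_of_hasCompactSupport hshift.2

lemma integral_shift_mul_shift
    (hA : ∀ α β : Zn n, ∫ p : Rn n × Rn n, Θ p * Φ (p.1 - toRn α, p.2 - toRn β) =
      if α = 0 ∧ β = 0 then 1 else 0) (μ ν μ' ν' : Zn n) :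
    ∫ p : Rn n × Rn n, Φ (p.1 - toRn μ', p.2 - toRn ν') * Θ (p.1 - toRn μ, p.2 - toRn ν) =
      if μ' = μ ∧ ν' = ν then 1 else 0 := by
  have : (volume : Measure (Rn n × Rn n)).IsAddRightInvariant :=
    inferInstanceAs ((volume : Measure (Rn n)).prod volume).IsAddRightInvariant
  have hshift := hA (μ' - μ) (ν' - ν)
  rw [← integral_sub_right_eq_self _ (toRn μ, toRn ν)] at hshift
  simp only [Prod.fst_sub, Prod.snd_sub, toRn_sub, sub_sub_sub_cancel_right, sub_eq_zero] at hshift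
  simp only [mul_comm (Φ _)]
  exact hshift

lemma integral_sigmaTrunc_mul (hΦ : IsTestFunction Φ) (hΘ : IsTestFunction Θ)
    (hA : ∀ α β : Zn n, ∫ p : Rn n × Rn n, Θ p * Φ (p.1 - toRn α, p.2 - toRn β) =
      if α = 0 ∧ β = 0 then 1 else 0) (a : Zn n → Zn n → ℂ) {μ ν : Zn n} {M : Finset (Zn n)}
    (hμ : μ ∈ M) (hν : ν ∈ M) :
    ∫ p, sigmaTrunc a Φ M p * Θ (p.1 - toRn μ, p.2 - toRn ν) = a μ ν := by
  obtain ⟨K, hK⟩ := hΦ.exists_nnnorm_bound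
  have hcont := hΦ.1.continuous
  have hint : ∀ μ' ν' : Zn n, Integrable fun p : Rn n × Rn n =>
      Φ (p.1 - toRn μ', p.2 - toRn ν') * Θ (p.1 - toRn μ, p.2 - toRn ν) := fun μ' ν' =>
    (hΘ.integrable_comp_sub_toRn μ ν).bdd_mul (Continuous.aestronglyMeasurable (by fun_prop))
      (.of_forall fun p => hK _)
  simp only [sigmaTrunc, Finset.sum_mul, mul_assoc]
  rw [integral_sum_sum M M a hint]
  simp only [integral_shift_mul_shift hA, mul_ite, mul_one, mul_zero, ite_and,
    Finset.sum_ite_irrel, Finset.sum_const_zero, Finset.sum_ite_eq', hμ, hν, if_true]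

lemma integral_sigma_mul (hΦ : IsTestFunction Φ) (hΘ : IsTestFunction Θ)
    (hA : ∀ α β : Zn n, ∫ p : Rn n × Rn n, Θ p * Φ (p.1 - toRn α, p.2 - toRn β) =
      if α = 0 ∧ β = 0 then 1 else 0) {a : Zn n → Zn n → ℂ} (ha : IsBoundedMatrix a)
    (μ ν : Zn n) : ∫ p, sigma a Φ p * Θ (p.1 - toRn μ, p.2 - toRn ν) = a μ ν := by
  obtain ⟨K, hK⟩ := exists_norm_sigmaTrunc_le hΦ ha
  have hint := hΘ.integrable_comp_sub_toRn μ ν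
  have hlim : Filter.Tendsto
      (fun M => ∫ p, sigmaTrunc a Φ M p * Θ (p.1 - toRn μ, p.2 - toRn ν)) Filter.atTop
      (nhds (∫ p, sigma a Φ p * Θ (p.1 - toRn μ, p.2 - toRn ν))) := by
    refine tendsto_integral_filter_of_dominated_convergence
      (fun p => K * ‖Θ (p.1 - toRn μ, p.2 - toRn ν)‖)
      (.of_forall fun M => (continuous_sigmaTrunc hΦ.1.continuous a M).aestronglyMeasurable.mul
        hint.aestronglyMeasurable)
      (.of_forall fun M => .of_forall fun p => ?_) (hint.norm.const_mul K)
      (.of_forall fun p => (tendsto_sigmaTrunc hΦ a p).mul_const _)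
    rw [norm_mul]
    gcongr
    exact hK M p
  refine tendsto_nhds_unique hlim (tendsto_const_nhds.congr' ?_)
  filter_upwards [Filter.eventually_ge_atTop {μ, ν}] with M hM
  exact (integral_sigmaTrunc_mul hΦ hΘ hA a (hM (by simp)) (hM (by simp))).symm

lemma integrable_window_mul_symbol (hθ : IsTestFunction θ) {σ : Rn n × Rn n → ℂ}
    (hσ : Measurable σ) {K : ℝ} (hK : ∀ p, ‖σ p‖ ≤ K) (y : Rn n) (μ ν : Zn n) :
    Integrable fun p : Rn n × Rn n =>
      θ (p.1 - toRn μ) * θ (p.2 - toRn ν) * (𝐞 ⟪y, p.1 + p.2⟫_ℝ * σ p) := by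
  have hwindow : ∀ μ : Zn n, Integrable fun ξ => θ (ξ - toRn μ) := fun μ =>
    have hshift := hθ.comp_sub_right (toRn μ)
    hshift.1.continuous.integrable_of_hasCompactSupport hshift.2
  exact (integrable_freqOp_integrand hσ hK (hwindow μ) (hwindow ν) y).congr
    (.of_forall fun p => by ring)

lemma freqOp_packetSum (hθ : IsTestFunction θ) {σ : Rn n × Rn n → ℂ}
    (hσ : Measurable σ) {K : ℝ} (hK : ∀ p, ‖σ p‖ ≤ K) (k l : Rn n) (M N : Finset (Zn n))
    (F G : Zn n → ℂ) (y : Rn n) :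
    freqOp σ (packetSum θ k M F) (packetSum θ l N G) y = ∑ μ ∈ M, ∑ ν ∈ N,
      F μ * G ν * ∫ p : Rn n × Rn n,
        packet θ k μ p.1 * packet θ l ν p.2 * (𝐞 ⟪y, p.1 + p.2⟫_ℝ * σ p) := by
  have hpacket : ∀ k μ, Integrable (packet θ k μ) := fun k μ =>
    have h := isTestFunction_packet hθ k μ
    h.1.continuous.integrable_of_hasCompactSupport h.2
  have hint : ∀ μ ν, Integrable fun p : Rn n × Rn n =>
      packet θ k μ p.1 * packet θ l ν p.2 * (𝐞 ⟪y, p.1 + p.2⟫_ℝ * σ p) := fun μ ν =>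
    (integrable_freqOp_integrand hσ hK (hpacket k μ) (hpacket l ν) y).congr
      (.of_forall fun p => by ring)
  rw [← integral_sum_sum M N (fun μ ν => F μ * G ν) hint, freqOp]
  refine integral_congr_ae (.of_forall fun p => ?_)
  simp only [packetSum]
  rw [mul_assoc (_ * _), Finset.sum_mul_sum]
  simp only [Finset.mul_sum]
  exact Finset.sum_congr rfl fun _ _ => Finset.sum_congr rfl fun _ _ => by ring

lemma IsSeparation.bilinTrig_eq_superpose (h : IsSeparation (-1) Θ W θ) {σ : Rn n × Rn n → ℂ}
    (hσ : Measurable σ) {K : ℝ} (hK : ∀ p, ‖σ p‖ ≤ K) {a : Zn n → Zn n → ℂ}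
    (hσa : ∀ μ ν, ∫ p, σ p * Θ (p.1 - toRn μ, p.2 - toRn ν) = a μ ν) (M N : Finset (Zn n))
    (F G : Zn n → ℂ) (hy : y ∈ cube n) :
    bilinTrig a M N F G y = superpose W (fun w =>
      freqOp σ (packetSum θ (w 1) M F) (packetSum θ (w 2) N G)) y := by
  have hθ := h.isTestFunction
  have hphase : ∀ (μ ν : Zn n) (ξ η : Rn n), (𝐞 (-1 * ⟪y, ξ - toRn μ + (η - toRn ν)⟫_ℝ) : ℂ) *
      𝐞 ⟪y, ξ + η⟫_ℝ = 𝐞 ⟪y, toRn (μ + ν)⟫_ℝ := fun μ ν ξ η => by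
    rw [← fourierChar_add]
    congr 2
    simp only [toRn_add, inner_add_right, inner_sub_right]
    ring
  simp only [superpose, freqOp_packetSum hθ hσ hK]
  rw [h.integral_sum_packet_mul_packet hy M N _ (integrable_window_mul_symbol hθ hσ hK y),
    bilinTrig]
  refine Finset.sum_congr rfl fun μ _ => Finset.sum_congr rfl fun ν _ => ?_
  calc a μ ν * F μ * G ν * 𝐞 ⟪y, toRn (μ + ν)⟫_ℝ
      = F μ * G ν * ∫ p, 𝐞 ⟪y, toRn (μ + ν)⟫_ℝ * (σ p * Θ (p.1 - toRn μ, p.2 - toRn ν)) := by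
        rw [integral_const_mul, hσa]
        ring
    _ = _ := by
        refine congrArg _ (integral_congr_ae (.of_forall fun p => ?_))
        beta_reduce
        rw [← hphase μ ν p.1 p.2]
        ring

lemma measurable_freqOp_packetSum (hθ : Continuous θ) {σ : Rn n × Rn n → ℂ} (hσ : Measurable σ)
    (M N : Finset (Zn n)) (F G : Zn n → ℂ) :
    Measurable (Function.uncurry fun w : Freq n =>
      freqOp σ (packetSum θ (w 1) M F) (packetSum θ (w 2) N G)) := by
  have hphase : Continuous fun q : (Freq n × Rn n) × (Rn n × Rn n) =>
      (𝐞 ⟪q.1.2, q.2.1 + q.2.2⟫_ℝ : ℂ) := by fun_prop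
  have hfst : Continuous fun q : (Freq n × Rn n) × (Rn n × Rn n) =>
      packetSum θ (q.1.1 1) M F q.2.1 := by unfold packetSum packet; fun_prop
  have hsnd : Continuous fun q : (Freq n × Rn n) × (Rn n × Rn n) =>
      packetSum θ (q.1.1 2) N G q.2.2 := by unfold packetSum packet; fun_prop
  exact (((hphase.measurable.mul (hσ.comp measurable_snd)).mul hfst.measurable).mul
    hsnd.measurable).stronglyMeasurable.integral_prod_right'.measurable

lemma exists_eLpNorm_superpose_freqOp_le (W : 𝓢(Freq n, ℂ)) (hθ : IsTestFunction θ) :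
    ∃ c : ℝ≥0, ∀ {σ : Rn n × Rn n → ℂ}, Measurable σ → ∀ (M N : Finset (Zn n)) (F G : Zn n → ℂ),
      eLpNorm (superpose W fun w => freqOp σ (packetSum θ (w 1) M F) (packetSum θ (w 2) N G)) 2
        (volume.restrict (cube n)) ≤
      c * (ell2 M F * ell2 N G) * multiplierNorm L2norm L2norm (amalgamNorm 2 ⊤) σ := by
  obtain ⟨D, hD⟩ := exists_L2norm_packetSum_le hθ
  obtain ⟨I, hI⟩ := exists_coe_eq_lintegral_enorm W
  refine ⟨I * D ^ 2, fun {σ} hσ M N F G => ?_⟩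
  set X := multiplierNorm L2norm L2norm (amalgamNorm 2 ⊤) σ
  calc _ ≤ ∫⁻ w, ‖W w‖ₑ * eLpNorm (freqOp σ (packetSum θ (w 1) M F) (packetSum θ (w 2) N G)) 2
          (volume.restrict (cube n)) :=
        eLpNorm_superpose_le W (measurable_freqOp_packetSum hθ.1.continuous hσ M N F G) _
    _ ≤ ∫⁻ w, ‖W w‖ₑ * (D * ell2 M F * (D * ell2 N G) * X) := by
        gcongr with w
        refine (eLpNorm_freqOp_le σ (isTestFunction_packetSum hθ _ M F)
          (isTestFunction_packetSum hθ _ N G)).trans ?_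
        gcongr
        exacts [hD _ M F, hD _ N G]
    _ = (I * D ^ 2 : ℝ≥0) * (ell2 M F * ell2 N G) * X := by
        rw [lintegral_mul_const _ W.continuous.measurable.enorm, ← hI]
        push_cast
        ring

lemma le_multiplierNorm_sigma (hΦ : IsTestFunction Φ) (hA : ConditionA Φ) :
    ∃ c : ℝ≥0, 0 < c ∧ ∀ a : Zn n → Zn n → ℂ, IsBoundedMatrix a →
      (c : ℝ≥0∞)⁻¹ * Bnorm a ≤ multiplierNorm L2norm L2norm (amalgamNorm 2 ⊤) (sigma a Φ) := by
  obtain ⟨Θ, hΘ, hA⟩ := hA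
  obtain ⟨W, θ, h⟩ := exists_isSeparation (-1) hΘ
  obtain ⟨c, hc⟩ := exists_eLpNorm_superpose_freqOp_le W h.isTestFunction
  refine ⟨c + 1, by positivity, fun a ha => ?_⟩
  obtain ⟨K, hK⟩ := exists_norm_sigma_le hΦ ha
  have hσ := measurable_sigma hΦ a
  rw [ENNReal.inv_mul_le_iff (by simp) ENNReal.coe_ne_top]
  refine iSup_le fun F => iSup_le fun G => iSup_le fun H => iSup_le fun hF => iSup_le fun hG =>
    iSup_le fun hH => ?_
  calc ‖trilinearForm a F G H‖ₑ
      ≤ eLpNorm (bilinTrig a F.support G.support F G) 2 (volume.restrict (cube n)) :=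
        enorm_trilinearForm_le_eLpNorm_bilinTrig a F G hH
    _ = eLpNorm (superpose W fun w => freqOp (sigma a Φ) (packetSum θ (w 1) F.support F)
          (packetSum θ (w 2) G.support G)) 2 (volume.restrict (cube n)) :=
        eLpNorm_congr_ae <| (ae_restrict_mem (measurableSet_cube n)).mono fun y hy =>
          h.bilinTrig_eq_superpose hσ hK (integral_sigma_mul hΦ hΘ hA ha) _ _ F G hy
    _ ≤ c * multiplierNorm L2norm L2norm (amalgamNorm 2 ⊤) (sigma a Φ) := by
        refine (hc hσ _ _ _ _).trans_eq ?_
        rw [ell2_eq_ofReal_l2norm subset_rfl, ell2_eq_ofReal_l2norm subset_rfl, hF, hG,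
          ENNReal.ofReal_one, mul_one, mul_one]
    _ ≤ (c + 1 : ℝ≥0) * multiplierNorm L2norm L2norm (amalgamNorm 2 ⊤) (sigma a Φ) := by
        gcongr
        exact le_self_add

end LowerBound

end BilinearMultiplier

end

theorem theorem1p3 (n : ℕ) (Φ : BilinearMultiplier.Rn n × BilinearMultiplier.Rn n → ℂ)
    (hΦ : BilinearMultiplier.IsTestFunction Φ) :
    (∃ c : ℝ≥0, 0 < c ∧
      ∀ a : BilinearMultiplier.Zn n → BilinearMultiplier.Zn n → ℂ,
        BilinearMultiplier.IsBoundedMatrix a →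
        BilinearMultiplier.multiplierNorm
            BilinearMultiplier.L2norm BilinearMultiplier.L2norm
            (BilinearMultiplier.amalgamNorm 2 1) (BilinearMultiplier.sigma a Φ) ≤
          (c : ℝ≥0∞) * BilinearMultiplier.Bnorm a) ∧
    (BilinearMultiplier.ConditionA Φ →
      ∃ c : ℝ≥0, 0 < c ∧
      ∀ a : BilinearMultiplier.Zn n → BilinearMultiplier.Zn n → ℂ,
        BilinearMultiplier.IsBoundedMatrix a →
        (c : ℝ≥0∞)⁻¹ * BilinearMultiplier.Bnorm a ≤
          BilinearMultiplier.multiplierNorm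
            BilinearMultiplier.L2norm BilinearMultiplier.L2norm
            (BilinearMultiplier.amalgamNorm 2 ∞) (BilinearMultiplier.sigma a Φ)) :=
  ⟨BilinearMultiplier.multiplierNorm_sigma_le hΦ, BilinearMultiplier.le_multiplierNorm_sigma hΦ⟩
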